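/- Let $\mathbb{K}$ be a number field of degree $n \ge 2$ with discriminant $\Delta_{\mathbb{K}}$, $r_1$ real places and $r_2$ complex places. Let $$f(s) = \left(\frac{2^{1-s}}{\pi^s}\right)^{n} |\Delta_{\mathbb{K}}|^{s-\frac12}\left(\cos\frac{\pi s}{2}\right)^{r_1+r_2}\left(\sin\frac{\pi s}{2}\right)^{r_2}\Gamma(s)^{n}$$ (this is the factor in the functional equation $\zeta_{\mathbb{K}}(1-s) = f(s)\zeta_{\mathbb{K}}(s)$ of the Dedekind zeta-function). For $w>0$ let $$K(w) = \frac{1}{2\pi i}\int_{-\frac12-\frac1{2n}-i\infty}^{-\frac12-\frac1{2n}+i\infty} \frac{w^{s+n}}{s(s+1)\cdots(s+n)}\, f(s)^{-1}\,ds ,$$ where the contour integral is understood as an improper integral (the limit of the integrals over the segments from $c-ia$ to $c+ib$ as $a,b\to\infty$ independently, $c$ being the real part of the line of integration). Then this improper integral converges for every $w>0$, and for every $0<\eta<\frac12$ the same integral taken over the line $\Re s=-\eta$ converges to the same value. Moreover $K$ is $n$ times continuously differentiable on $(0,\infty)$, and for every $w>0$ its $n$-th derivative is given by the convergent improper integral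 $$K^{(n)}(w) = \frac{1}{2\pi i}\int_{\frac12-\frac1{2n}-i\infty}^{\frac12-\frac1{2n}+i\infty} \frac{w^{s}}{s}\, f(s)^{-1}\,ds .$$ For every $w>0$ we have $$|K(w)| \le Q_2(n)\, |\Delta_{\mathbb{K}}|^{1+\frac{1}{2n}}\, w^{n-\frac12-\frac1{2n}}, \qquad |K^{(n)}(w)| \le Q_3(n)\, |\Delta_{\mathbb{K}}|^{\frac{1}{2n}}\, w^{\frac12-\frac1{2n}},$$ where $$Q_2(n) = 2^{\frac32}\pi^{-\frac n2-\frac32} e^{4n-\frac12}\sqrt{3n}, \qquad Q_3(n) = 2^{n+\frac32}\pi^{\frac n2-\frac32} e^{n\left(1+\frac{4n}{n-1}\right)-\frac12}\sqrt{3n}.$$ -/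

import Mathlib

open Filter Topology

noncomputable section

namespace LandauKernel

/-- The truncated contour integral `(2πi)⁻¹ ∫ F(s) ds` over the segment from `c - i a` to `c + i b`. -/
def truncatedVerticalIntegral (F : ℂ → ℂ) (c a b : ℝ) : ℂ :=
  (2 * (Real.pi : ℂ) * Complex.I)⁻¹ *
    ∫ t in (-a)..b, F ((c : ℂ) + (t : ℂ) * Complex.I) * Complex.I

/-- The improper contour integral `(2πi)⁻¹ ∫_{c - i∞}^{c + i∞} F(s) ds` converges to `I`:
the two ends of the segment of integration tend to infinity independently of each other.
Absolute convergence is not required. -/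
def HasVerticalIntegral (F : ℂ → ℂ) (c : ℝ) (I : ℂ) : Prop :=
  Tendsto (fun p : ℝ × ℝ => truncatedVerticalIntegral F c p.1 p.2) (atTop ×ˢ atTop) (𝓝 I)

/-- The value of the improper contour integral `(2πi)⁻¹ ∫_{c - i∞}^{c + i∞} F(s) ds`
(meaningful when the integral converges). -/
def verticalIntegral (F : ℂ → ℂ) (c : ℝ) : ℂ :=
  limUnder (atTop ×ˢ atTop) fun p : ℝ × ℝ => truncatedVerticalIntegral F c p.1 p.2

variable (K : Type*) [Field K] [NumberField K]

/-- The degree of the number field `K`. -/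
def degree : ℕ := Module.finrank ℚ K

/-- The absolute value of the discriminant of the number field `K`. -/
def absDiscr : ℝ := ((|NumberField.discr K| : ℤ) : ℝ)

/-- The factor `f(s)` in the functional equation `ζ_K(1 - s) = f(s) ζ_K(s)`:
`f(s) = (2^(1-s) / π^s)^n |Δ_K|^(s-1/2) cos(πs/2)^(r₁+r₂) sin(πs/2)^r₂ Γ(s)^n`. -/
def gammaFactor (s : ℂ) : ℂ :=
  ((2 : ℂ) ^ (1 - s) / (Real.pi : ℂ) ^ s) ^ degree K
    * (absDiscr K : ℂ) ^ (s - 1 / 2)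
    * Complex.cos ((Real.pi : ℂ) * s / 2) ^
        (NumberField.InfinitePlace.nrRealPlaces K + NumberField.InfinitePlace.nrComplexPlaces K)
    * Complex.sin ((Real.pi : ℂ) * s / 2) ^ NumberField.InfinitePlace.nrComplexPlaces K
    * Complex.Gamma s ^ degree K

/-- The integrand `w^(s+n) / (s (s+1) ⋯ (s+n)) · f(s)⁻¹` of `K(w)`. -/
def kernelIntegrand (w : ℝ) (s : ℂ) : ℂ :=
  (w : ℂ) ^ (s + (degree K : ℂ)) / (∏ j ∈ Finset.range (degree K + 1), (s + (j : ℂ)))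
    * (gammaFactor K s)⁻¹

/-- The abscissa `-1/2 - 1/(2n)` of the line of integration of `K(w)`. -/
def kernelLine : ℝ := -(1 / 2) - 1 / (2 * (degree K : ℝ))

/-- `K(w) = (2πi)⁻¹ ∫ w^(s+n) / (s (s+1) ⋯ (s+n)) · f(s)⁻¹ ds` over `Re s = -1/2 - 1/(2n)`. -/
def kernel (w : ℝ) : ℂ := verticalIntegral (kernelIntegrand K w) (kernelLine K)

/-- The integrand `w^s / s · f(s)⁻¹` of the `n`-th derivative of `K(w)`. -/
def kernelDerivIntegrand (w : ℝ) (s : ℂ) : ℂ :=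
  (w : ℂ) ^ s / s * (gammaFactor K s)⁻¹

/-- The abscissa `1/2 - 1/(2n)` of the line of integration of the `n`-th derivative of `K(w)`. -/
def kernelDerivLine : ℝ := 1 / 2 - 1 / (2 * (degree K : ℝ))

/-- `Q₂(n) = 2^(3/2) π^(-n/2-3/2) e^(4n-1/2) √(3n)`. -/
def Q₂ (n : ℕ) : ℝ :=
  (2 : ℝ) ^ (3 / 2 : ℝ) * Real.pi ^ (-(n : ℝ) / 2 - 3 / 2) * Real.exp (4 * (n : ℝ) - 1 / 2)
    * Real.sqrt (3 * (n : ℝ))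

/-- `Q₃(n) = 2^(n+3/2) π^(n/2-3/2) e^(n(1+4n/(n-1))-1/2) √(3n)`. -/
def Q₃ (n : ℕ) : ℝ :=
  (2 : ℝ) ^ ((n : ℝ) + 3 / 2) * Real.pi ^ ((n : ℝ) / 2 - 3 / 2)
    * Real.exp ((n : ℝ) * (1 + 4 * (n : ℝ) / ((n : ℝ) - 1)) - 1 / 2)
    * Real.sqrt (3 * (n : ℝ))

end LandauKernel

end

noncomputable section

namespace LandauKernel

/-! ### Oscillatory integrals with phase t (log t - L) - t -/

section OscillatoryIntegrals

open MeasureTheory Set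

/-! Put p = r₁ + r₂, q = r₂, n = p + q and D = |Δ|. The duplication formula for the sine and Euler's
reflection formula give f(s)⁻¹ = f(1 - s), so both integrands are instances of `mellinIntegrand`,
that is w^(s+m) f(1 - s) / (s (s+1) ⋯ (s+m)), with m = n for K and m = 0 for its n-th derivative.
The point s = 0 is a removable singularity because f(1) = 0.

By Stirling's formula this function has size |t|^(n(1/2-σ)-1-m) on Re s = σ. On Re s = 3/4 the
integral converges absolutely and defines `mellinIntegral`; differentiation under the integral sign
shows that the derivative of the integral with index m+1 is the one with index m
(`hasDerivAt_mellinIntegral`). This yields smoothness and the n-th derivative. By Cauchy's theorem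
the line may be moved left as long as the integrand stays O(|t|^(-1/2))
(`hasVerticalIntegral_mellinIntegrand`). The two lines in the theorem are the extreme ones, where
the size is exactly |t|^(-1/2) and convergence is only conditional.

The bounds are read off on these extreme lines, since there the power of w is the required one. For
|t| ≥ 1 the integrand is a constant times t^(-1/2) exp(i n (t (log t - L) - t)), up to an error
O(t^(-3/2)) (`exists_norm_mellinIntegrand_sub_le`), where w enters the phase only through L. A
second derivative test bounds the oscillating part uniformly in L
(`norm_integral_rpow_exp_phase_le`), hence uniformly in w. The part |t| ≤ 1 is estimated trivially,
and the total constant is well below Q₂ and Q₃. -/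

/-- A form of van der Corput's second derivative test, adapted to phases `ν (u² log u² - u²)`. -/
lemma norm_integral_exp_phase_le {ν L B : ℝ} (hν : 2 ≤ ν) (hB : 1 ≤ B) :
    ‖∫ u in (1 : ℝ)..B, Complex.exp (Complex.I *
      ((ν * (u ^ 2 * (2 * Real.log u - L) - u ^ 2) : ℝ) : ℂ))‖ ≤ 13 / 2 := by
  have hν0 : 0 < ν := by linarith
  obtain ⟨μ, hμ2, hμ0⟩ : ∃ μ : ℝ, μ ^ 2 = 2 * ν ∧ 2 ≤ μ :=
    ⟨Real.sqrt (2 * ν), Real.sq_sqrt (by linarith), Real.le_sqrt_of_sq_le (by linarith)⟩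
  have hμp : 0 < μ := by linarith
  set ψ : ℝ → ℝ := fun u => ν * (u ^ 2 * (2 * Real.log u - L) - u ^ 2) with hψ
  set P : ℝ → ℝ := fun u => 2 * ν * u * (2 * Real.log u - L) with hP
  set Q : ℝ → ℝ := fun u => 2 * ν * (2 * Real.log u - L) + 4 * ν with hQ
  set S : ℝ → ℝ := fun u => P u ^ 2 + μ ^ 2 with hS
  have hSpos : ∀ u, 0 < S u := fun u => by simp only [hS]; positivity
  have dψ : ∀ u : ℝ, 0 < u → HasDerivAt ψ (P u) u := by
    intro u hu
    have h1 := Real.hasDerivAt_log hu.ne'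
    have h2 := (((hasDerivAt_pow 2 u).mul ((h1.const_mul 2).sub_const L)).sub
      (hasDerivAt_pow 2 u)).const_mul ν
    refine h2.congr_deriv ?_
    simp only [hP]
    field_simp
    norm_num
    ring
  have dP : ∀ u : ℝ, 0 < u → HasDerivAt P (Q u) u := by
    intro u hu
    have h1 := Real.hasDerivAt_log hu.ne'
    have h2 := ((hasDerivAt_id u).const_mul (2 * ν)).mul ((h1.const_mul 2).sub_const L)
    refine h2.congr_deriv ?_
    simp only [hQ, id]
    field_simp
    ring
  set E : ℝ → ℂ := fun u => Complex.exp (Complex.I * (ψ u : ℂ)) with hE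
  have hEn : ∀ u, ‖E u‖ = 1 := fun u => by
    simp only [hE]; rw [mul_comm]; exact Complex.norm_exp_ofReal_mul_I _
  have dE : ∀ u : ℝ, 0 < u → HasDerivAt E (E u * (Complex.I * (P u : ℂ))) u := by
    intro u hu
    exact ((dψ u hu).ofReal_comp.const_mul Complex.I).cexp
  -- Since E' = i P E, the function -i E / P is nearly a primitive of E, but it blows up at a
  -- stationary point. Replacing 1/P by P / (P² + μ²) removes the pole and costs an error of size
  -- (μ² + |Q|) / S.
  set R : ℝ → ℝ := fun u => P u / S u with hR
  set R' : ℝ → ℝ := fun u => Q u * (μ ^ 2 - P u ^ 2) / S u ^ 2 with hR'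
  have dR : ∀ u : ℝ, 0 < u → HasDerivAt R (R' u) u := by
    intro u hu
    have h1 := (dP u hu).div (((dP u hu).pow 2).add_const (μ ^ 2)) (hSpos u).ne'
    refine h1.congr_deriv ?_
    simp only [hR', hS, Pi.pow_apply]
    congr 1
    push_cast
    ring
  set V : ℝ → ℂ := fun u => E u * (-Complex.I * (R u : ℂ)) with hV
  set V' : ℝ → ℂ := fun u =>
    E u * (Complex.I * (P u : ℂ)) * (-Complex.I * (R u : ℂ)) + E u * (-Complex.I * (R' u : ℂ))
    with hV'
  have dV : ∀ u : ℝ, 0 < u → HasDerivAt V (V' u) u := fun u hu =>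
    (dE u hu).mul ((dR u hu).ofReal_comp.const_mul (-Complex.I))
  -- A primitive of a majorant of that error. The arctangent has total variation at most π whatever
  -- L is, which makes the final bound uniform; the term in 1/u pays for the range where the phase
  -- is not sufficiently convex.
  set W : ℝ → ℝ := fun u => 2 / μ * Real.arctan (P u / μ) - 5 / ν * u⁻¹ with hW
  set W' : ℝ → ℝ := fun u => 2 * Q u / S u + 5 / (ν * u ^ 2) with hW'
  have dW : ∀ u : ℝ, 0 < u → HasDerivAt W (W' u) u := by
    intro u hu
    have h1 := ((((dP u hu).div_const μ).arctan).const_mul (2 / μ)).sub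
      ((hasDerivAt_inv hu.ne').const_mul (5 / ν))
    refine h1.congr_deriv ?_
    have h2 := (hSpos u).ne'
    have h3 : 1 + (P u / μ) ^ 2 = S u / μ ^ 2 := by
      simp only [hS]; field_simp; ring
    rw [h3]
    simp only [hW']
    field_simp
    ring
  have hsub : ∀ u ∈ uIcc 1 B, 0 < u := by
    intro u hu
    rw [uIcc_of_le hB] at hu
    linarith [hu.1]
  have cP : ContinuousOn P (uIcc 1 B) := fun u hu =>
    (dP u (hsub u hu)).continuousAt.continuousWithinAt
  have clog : ContinuousOn Real.log (uIcc 1 B) := fun u hu =>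
    (Real.continuousAt_log (hsub u hu).ne').continuousWithinAt
  have cQ : ContinuousOn Q (uIcc 1 B) := by simp only [hQ]; fun_prop
  have cE : ContinuousOn E (uIcc 1 B) := fun u hu =>
    (dE u (hsub u hu)).continuousAt.continuousWithinAt
  have cS : ContinuousOn S (uIcc 1 B) := by simp only [hS]; fun_prop
  have cR : ContinuousOn R (uIcc 1 B) := cP.div cS fun u _ => (hSpos u).ne'
  have cR' : ContinuousOn R' (uIcc 1 B) :=
    (cQ.mul (continuousOn_const.sub (cP.pow 2))).div (cS.pow 2)
      fun u _ => pow_ne_zero 2 (hSpos u).ne'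
  have cRc : ContinuousOn (fun u => (R u : ℂ)) (uIcc 1 B) :=
    Complex.continuous_ofReal.comp_continuousOn cR
  have cRc' : ContinuousOn (fun u => (R' u : ℂ)) (uIcc 1 B) :=
    Complex.continuous_ofReal.comp_continuousOn cR'
  have cPc : ContinuousOn (fun u => (P u : ℂ)) (uIcc 1 B) :=
    Complex.continuous_ofReal.comp_continuousOn cP
  have cV' : ContinuousOn V' (uIcc 1 B) := by simp only [hV']; fun_prop
  have cW' : ContinuousOn W' (uIcc 1 B) := by
    refine ((cQ.const_mul 2 : ContinuousOn (fun u => 2 * Q u) _).div cS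
      fun u _ => (hSpos u).ne').add ?_
    refine continuousOn_const.div (by fun_prop) fun u hu => ?_
    have := hsub u hu
    positivity
  have hRle : ∀ u, |R u| ≤ 1 / (2 * μ) := by
    intro u
    simp only [hR]
    rw [abs_div, abs_of_pos (hSpos u), div_le_div_iff₀ (hSpos u) (by positivity)]
    simp only [hS]
    nlinarith [sq_nonneg (|P u| - μ), sq_abs (P u)]
  have hVle : ∀ u, ‖V u‖ ≤ 1 / (2 * μ) := by
    intro u
    simp only [hV, norm_mul, hEn, norm_neg, Complex.norm_I, one_mul, Complex.norm_real]
    exact hRle u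
  have hint : ∫ u in (1 : ℝ)..B, E u = (V B - V 1) + ∫ u in (1 : ℝ)..B, (E u - V' u) := by
    rw [intervalIntegral.integral_sub cE.intervalIntegrable cV'.intervalIntegrable,
      intervalIntegral.integral_eq_sub_of_hasDerivAt (fun u hu => dV u (hsub u hu))
        cV'.intervalIntegrable]
    ring
  have hdiff : ∀ u, 0 < u → ‖E u - V' u‖ ≤ W' u := by
    intro u hu
    have hS0 := hSpos u
    have hS0c : (S u : ℂ) ≠ 0 := by exact_mod_cast hS0.ne'
    have e1 : E u - V' u = E u * (((μ ^ 2 / S u : ℝ) : ℂ) + Complex.I * (R' u : ℂ)) := by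
      have : ((μ ^ 2 / S u : ℝ) : ℂ) = 1 - (P u : ℂ) * (R u : ℂ) := by
        norm_cast
        simp only [hR]
        field_simp
        simp only [hS]
        ring
      rw [this]
      simp only [hV']
      linear_combination (E u * (P u : ℂ) * (R u : ℂ)) * Complex.I_sq
    rw [e1, norm_mul, hEn, one_mul]
    refine (norm_add_le _ _).trans ?_
    rw [norm_mul, Complex.norm_I, one_mul, Complex.norm_real, Complex.norm_real, Real.norm_eq_abs,
      Real.norm_eq_abs, abs_of_pos (by positivity : 0 < μ ^ 2 / S u)]
    have e2 : |R' u| ≤ |Q u| / S u := by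
      simp only [hR']
      rw [abs_div, abs_mul, abs_of_pos (by positivity : 0 < S u ^ 2),
        div_le_div_iff₀ (by positivity) hS0]
      have : |μ ^ 2 - P u ^ 2| ≤ S u := by
        simp only [hS]
        rw [abs_le]
        constructor <;> nlinarith [sq_nonneg (P u), sq_nonneg μ]
      calc |Q u| * |μ ^ 2 - P u ^ 2| * S u ≤ |Q u| * S u * S u := by gcongr
        _ = _ := by ring
    have e3 : μ ^ 2 + |Q u| - 2 * Q u ≤ 5 / (ν * u ^ 2) * S u := by
      -- For x = 2 log u - L ≥ -1 one has Q ≥ 2ν = μ², so 2Q alone suffices. For x < -1 the phase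
      -- moves fast: 5 P² / (ν u²) = 20 ν x² outweighs every other term.
      rcases le_or_gt (-1) (2 * Real.log u - L) with hl | hl
      · have hq : 2 * ν ≤ Q u := by simp only [hQ]; nlinarith
        rw [abs_of_pos (by linarith)]
        have : 0 ≤ 5 / (ν * u ^ 2) * S u := by positivity
        linarith
      · set x := 2 * Real.log u - L with hx
        have hq : |Q u| ≤ -(2 * ν * x) + 4 * ν := by
          simp only [hQ, ← hx]
          rw [abs_le]
          constructor <;> nlinarith
        have hPx : 5 / (ν * u ^ 2) * P u ^ 2 = 20 * ν * x ^ 2 := by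
          simp only [hP, ← hx]
          field_simp
          ring
        have h5 : 5 / (ν * u ^ 2) * S u = 20 * ν * x ^ 2 + 5 / (ν * u ^ 2) * μ ^ 2 := by
          simp only [hS]
          rw [mul_add, hPx]
        have h6 : 0 ≤ 5 / (ν * u ^ 2) * μ ^ 2 := by positivity
        have h7 : -2 * Q u ≤ 2 * |Q u| := by linarith [neg_abs_le (Q u)]
        have h8 : 0 ≤ ν * ((-x - 1) * (-x)) :=
          mul_nonneg hν0.le (mul_nonneg (by linarith) (by linarith))
        have h9 : 0 ≤ ν * (-x - 1) := mul_nonneg hν0.le (by linarith)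
        rw [h5]
        nlinarith
    calc μ ^ 2 / S u + |R' u| ≤ μ ^ 2 / S u + |Q u| / S u := by gcongr
      _ = (2 * Q u + (μ ^ 2 + |Q u| - 2 * Q u)) / S u := by rw [← add_div]; ring
      _ ≤ (2 * Q u + 5 / (ν * u ^ 2) * S u) / S u := by gcongr
      _ = W' u := by simp only [hW']; field_simp
  have hrem : ‖∫ u in (1 : ℝ)..B, (E u - V' u)‖ ≤ W B - W 1 := by
    rw [← intervalIntegral.integral_eq_sub_of_hasDerivAt (fun u hu => dW u (hsub u hu))
        cW'.intervalIntegrable]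
    refine intervalIntegral.norm_integral_le_of_norm_le hB (ae_of_all _ fun u hu => ?_)
      cW'.intervalIntegrable
    exact hdiff u (by linarith [hu.1])
  have hWd : W B - W 1 ≤ 2 / μ * Real.pi + 5 / ν := by
    simp only [hW]
    have h1 := (Real.arctan_lt_pi_div_two (P B / μ)).le
    have h2 := (Real.neg_pi_div_two_lt_arctan (P 1 / μ)).le
    have h3 : 2 / μ * (Real.arctan (P B / μ) - Real.arctan (P 1 / μ)) ≤ 2 / μ * Real.pi := by
      gcongr; linarith
    have h4 : 0 ≤ 5 / ν * B⁻¹ := by positivity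
    rw [inv_one]
    linarith
  have hμi : 1 / μ ≤ 1 / 2 := one_div_le_one_div_of_le (by norm_num) hμ0
  have hνi : 1 / ν ≤ 1 / 2 := one_div_le_one_div_of_le (by norm_num) hν
  have hfin : ‖∫ u in (1 : ℝ)..B, E u‖ ≤ 13 / 2 := by
    rw [hint]
    refine (norm_add_le _ _).trans ?_
    have h1 : ‖V B - V 1‖ ≤ 1 / μ := by
      refine (norm_sub_le _ _).trans ((add_le_add (hVle B) (hVle 1)).trans (le_of_eq ?_))
      field_simp
      norm_num
    have h2 : 2 / μ * Real.pi ≤ 3.15 := by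
      calc 2 / μ * Real.pi = 1 / μ * (2 * Real.pi) := by ring
        _ ≤ 1 / 2 * (2 * Real.pi) := by gcongr
        _ ≤ 3.15 := by linarith [Real.pi_lt_d2]
    have h3 : 5 / ν ≤ 5 / 2 := by
      calc 5 / ν = 5 * (1 / ν) := by ring
        _ ≤ 5 * (1 / 2) := by gcongr
        _ = _ := by norm_num
    linarith
  exact hfin

/-- The second derivative of this phase, ν/t, tends to 0. The substitution t = u² absorbs the weight
t^(-1/2) into the measure and gives a phase whose second derivative is eventually bounded below. -/
lemma norm_integral_rpow_exp_phase_le {ν L B : ℝ} (hν : 2 ≤ ν) (hB : 1 ≤ B) :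
    ‖∫ t in (1 : ℝ)..B, ((t ^ (-(1 / 2) : ℝ) : ℝ) : ℂ) * Complex.exp (Complex.I *
      ((ν * (t * (Real.log t - L) - t) : ℝ) : ℂ))‖ ≤ 13 := by
  set g : ℝ → ℂ := fun t => ((t ^ (-(1 / 2) : ℝ) : ℝ) : ℂ) * Complex.exp (Complex.I *
      ((ν * (t * (Real.log t - L) - t) : ℝ) : ℂ)) with hg
  have hB1 : 1 ≤ Real.sqrt B := Real.one_le_sqrt.mpr hB
  have hsub : ∀ u ∈ uIcc 1 (Real.sqrt B), 0 < u := by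
    intro u hu
    rw [uIcc_of_le hB1] at hu
    linarith [hu.1]
  have key : ∫ u in (1 : ℝ)..(Real.sqrt B), (2 * u) • (g ∘ fun u => u ^ 2) u = ∫ t in (1 : ℝ)..B, g t := by
    have h := intervalIntegral.integral_deriv_smul_comp' (a := 1) (b := Real.sqrt B)
      (f := fun u : ℝ => u ^ 2) (f' := fun u => 2 * u) (g := g)
    rw [h]
    · rw [Real.sq_sqrt (by linarith)]
      norm_num
    · intro u _
      simpa using hasDerivAt_pow 2 u
    · fun_prop
    · intro t ht
      obtain ⟨u, hu, rfl⟩ := ht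
      have hu0 := hsub u hu
      have hu2 : u ^ 2 ≠ 0 := by positivity
      have h1 := Real.continuousAt_log hu2
      have h2 : ContinuousAt (fun t : ℝ => t ^ (-(1 / 2) : ℝ)) (u ^ 2) :=
        Real.continuousAt_rpow_const _ _ (Or.inl hu2)
      refine ContinuousAt.continuousWithinAt ?_
      simp only [hg]
      fun_prop
  rw [← key]
  have h2 : ∫ u in (1 : ℝ)..(Real.sqrt B), (2 * u) • (g ∘ fun u => u ^ 2) u
      = ∫ u in (1 : ℝ)..(Real.sqrt B), (2 : ℂ) * Complex.exp (Complex.I *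
      ((ν * (u ^ 2 * (2 * Real.log u - L) - u ^ 2) : ℝ) : ℂ)) := by
    refine intervalIntegral.integral_congr fun u hu => ?_
    have hu0 := hsub u hu
    have h3 : (u ^ 2) ^ (-(1 / 2) : ℝ) = u⁻¹ := by
      rw [← Real.rpow_natCast, ← Real.rpow_mul hu0.le]
      norm_num
      rw [Real.rpow_neg_one]
    simp only [hg, Function.comp, h3, Real.log_pow, Nat.cast_ofNat]
    rw [Complex.real_smul, ← mul_assoc]
    congr 1
    norm_cast
    field_simp
  rw [h2, intervalIntegral.integral_const_mul, norm_mul]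
  have := norm_integral_exp_phase_le (L := L) hν hB1
  rw [Complex.norm_ofNat]
  linarith

end OscillatoryIntegrals

/-! ### Stirling's formula with an explicit error -/

section Stirling

/-- A multiplicative way of saying that `x` is close to `1`, with relative error `c`. -/
def NearOne (c : ℝ) (x : ℂ) : Prop := ‖x - 1‖ ≤ Real.exp c - 1

namespace NearOne

lemma mono {c d : ℝ} {x : ℂ} (h : NearOne c x) (hcd : c ≤ d) : NearOne d x :=
  le_trans h (by gcongr)

lemma mul {c d : ℝ} {x y : ℂ} (hx : NearOne c x) (hy : NearOne d y) : NearOne (c + d) (x * y) := by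
  unfold NearOne at *
  have h1 : x * y - 1 = (x - 1) * (y - 1) + (x - 1) + (y - 1) := by ring
  have h2 : 0 ≤ Real.exp c - 1 := (norm_nonneg _).trans hx
  calc ‖x * y - 1‖ ≤ ‖x - 1‖ * ‖y - 1‖ + ‖x - 1‖ + ‖y - 1‖ := by
        rw [h1, ← norm_mul]; exact norm_add₃_le
    _ ≤ (Real.exp c - 1) * (Real.exp d - 1) + (Real.exp c - 1) + (Real.exp d - 1) := by gcongr
    _ = _ := by rw [Real.exp_add]; ring

lemma one : NearOne 0 1 := by simp [NearOne]

lemma pow {c : ℝ} {x : ℂ} (hx : NearOne c x) (n : ℕ) : NearOne (n * c) (x ^ n) := by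
  induction n with
  | zero => simpa using one
  | succ k ih =>
    rw [pow_succ, Nat.cast_succ, add_mul, one_mul]
    exact ih.mul hx

lemma norm_le {c : ℝ} {x : ℂ} (hx : NearOne c x) : ‖x‖ ≤ Real.exp c := by
  have h1 : ‖x‖ ≤ ‖x - 1‖ + 1 := by
    simpa using norm_add_le (x - 1) (1 : ℂ)
  have h2 : ‖x - 1‖ ≤ Real.exp c - 1 := hx
  linarith

end NearOne

lemma nearOne_exp (u : ℂ) : NearOne ‖u‖ (Complex.exp u) := by
  simpa [NearOne] using Complex.norm_exp_sub_sum_le_exp_norm_sub_sum u 1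

lemma norm_sub_le_of_norm_hasDerivAt_le {f f' : ℝ → ℂ} {W W' : ℝ → ℝ} {a b : ℝ} (hab : a ≤ b)
    (hf : ∀ x ∈ Set.Icc a b, HasDerivAt f (f' x) x) (hW : ∀ x, HasDerivAt W (W' x) x)
    (hle : ∀ x ∈ Set.Icc a b, ‖f' x‖ ≤ W' x) : ‖f b - f a‖ ≤ W b - W a := by
  refine image_norm_le_of_norm_deriv_right_le_deriv_boundary (f := fun x => f x - f a) (f' := f')
    (B := fun x => W x - W a) (B' := W') (a := a) (b := b)
    (fun x hx => ((hf x hx).continuousAt.sub continuousAt_const).continuousWithinAt)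
    (fun x hx => ((hf x ⟨hx.1, hx.2.le⟩).sub_const _).hasDerivWithinAt) (by simp)
    (fun x => (hW x).sub_const _) (fun x hx => hle x ⟨hx.1, hx.2.le⟩) ⟨hab, le_rfl⟩

/-- The Gamma function divided by the main factor of Stirling's formula. -/
def stirlingQuotient (z : ℂ) : ℂ :=
  Complex.Gamma z * Complex.exp (z - (z - 1 / 2) * Complex.log z)

/-- The increment of `log (stirlingQuotient z)`. -/
def binetIncrement (z : ℂ) : ℂ :=
  (z + 1 / 2) * (Complex.log (z + 1) - Complex.log z) - 1

lemma norm_add_ofReal_ge {z : ℂ} (hz : 0 < z.re) {u : ℝ} (hu : 0 ≤ u) : ‖z‖ ≤ ‖z + u‖ := by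
  rw [Complex.norm_def, Complex.norm_def]
  refine Real.sqrt_le_sqrt ?_
  simp only [Complex.normSq_apply, Complex.add_re, Complex.add_im, Complex.ofReal_re,
    Complex.ofReal_im, add_zero]
  nlinarith

/-- This is the midpoint-type error of ∫ (z + 1/2)/(z + u) du over [0, 1]: the first-order terms
cancel around u = 1/2, and ∫ (u - 1/2)² du = 1/12. -/
lemma norm_binetIncrement_le {z : ℂ} (hz : 0 < z.re) :
    ‖binetIncrement z‖ ≤ 1 / (12 * ‖z‖ ^ 2) := by
  have hz0 : z ≠ 0 := by rintro rfl; simp at hz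
  have hzn : 0 < ‖z‖ := norm_pos_iff.mpr hz0
  have hzu : ∀ u : ℝ, 0 ≤ u → z + u ≠ 0 := fun u hu h => by
    have := congrArg Complex.re h
    simp at this
    linarith
  have hz2 : z + 1 / 2 ≠ 0 := by simpa using hzu (1 / 2) (by norm_num)
  -- The subtracted multiple of u/2 - u²/2 vanishes at both endpoints, so the increment is
  -- unchanged, while the derivative acquires the factor (1/2 - u)².
  have key := norm_sub_le_of_norm_hasDerivAt_le (a := 0) (b := 1) zero_le_one
    (f := fun u : ℝ => (z + 1 / 2) * Complex.log (z + u) - u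
      - ((u : ℂ) / 2 - (u : ℂ) ^ 2 / 2) / (z + 1 / 2))
    (f' := fun u : ℝ => (1 / 2 - (u : ℂ)) ^ 2 / ((z + u) * (z + 1 / 2)))
    (W := fun u : ℝ => (u - 1 / 2) ^ 3 / (3 * ‖z‖ ^ 2))
    (W' := fun u : ℝ => (u - 1 / 2) ^ 2 / ‖z‖ ^ 2) ?_ ?_ ?_
  · refine le_trans (le_of_eq ?_) (key.trans (le_of_eq ?_))
    · congr 1
      simp only [binetIncrement]
      push_cast
      simp
      ring
    · field_simp
      norm_num
  · intro u hu
    have h0 : HasDerivAt (fun u : ℝ => (u : ℂ)) 1 u := Complex.ofRealCLM.hasDerivAt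
    have hs : z + u ∈ Complex.slitPlane := by
      left
      simp
      linarith [hu.1]
    have h1 : HasDerivAt (fun u : ℝ => Complex.log (z + u)) (1 / (z + u)) u :=
      (h0.const_add z).clog_real hs
    have h2 := ((h1.const_mul (z + 1 / 2)).sub h0).sub
      (((h0.div_const 2).sub ((h0.pow 2).div_const 2)).div_const (z + 1 / 2))
    refine h2.congr_deriv ?_
    have h3 := hzu u hu.1
    obtain ⟨c, hc⟩ : ∃ c, c = z + 1 / 2 := ⟨_, rfl⟩
    have h4 : z + u = c + u - 1 / 2 := by rw [hc]; ring
    rw [← hc] at hz2 ⊢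
    have h5 : (z + u)⁻¹ * (z + u) = 1 := inv_mul_cancel₀ h3
    rw [eq_div_iff (mul_ne_zero h3 hz2)]
    have h6 : (c * (1 / (z + u)) - 1 - (1 / 2 - (2 : ℕ) * (u : ℂ) ^ (2 - 1) * 1 / 2) / c)
        * ((z + u) * c) = c * c * ((z + u)⁻¹ * (z + u)) - (z + u) * c - (1 / 2 - u) * (z + u) := by
      field_simp
      norm_num
      left
      ring
    rw [h6, h5, h4]
    ring
  · intro u
    have h2 := ((((hasDerivAt_id u).sub_const (1 / 2)).pow 3).div_const (3 * ‖z‖ ^ 2))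
    refine h2.congr_deriv ?_
    simp
    field_simp
  · intro u hu
    rw [norm_div, norm_pow, norm_mul]
    have e1 : ‖(1 / 2 - (u : ℂ))‖ ^ 2 = (u - 1 / 2) ^ 2 := by
      have : (1 / 2 - (u : ℂ)) = ((1 / 2 - u : ℝ) : ℂ) := by push_cast; ring
      rw [this, Complex.norm_real, Real.norm_eq_abs, sq_abs]
      ring
    rw [e1, sq ‖z‖]
    gcongr
    · exact norm_add_ofReal_ge hz hu.1
    · simpa using norm_add_ofReal_ge hz (u := 1 / 2) (by norm_num)

lemma stirlingQuotient_eq_mul_exp {z : ℂ} (hz : 0 < z.re) :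
    stirlingQuotient z = stirlingQuotient (z + 1) * Complex.exp (binetIncrement z) := by
  have hz0 : z ≠ 0 := by rintro rfl; simp at hz
  simp only [stirlingQuotient, binetIncrement]
  rw [Complex.Gamma_add_one z hz0, mul_assoc, mul_assoc, ← Complex.exp_add]
  have h1 : ∀ A : ℂ, z * Complex.exp A = Complex.exp (Complex.log z + A) := fun A => by
    rw [Complex.exp_add, Complex.exp_log hz0]
  rw [mul_left_comm, h1]
  congr 2
  ring

lemma stirlingQuotient_eq_mul_exp_sum {z : ℂ} (hz : 0 < z.re) (N : ℕ) :
    stirlingQuotient z = stirlingQuotient (z + N) *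
      Complex.exp (∑ k ∈ Finset.range N, binetIncrement (z + k)) := by
  induction N with
  | zero => simp
  | succ N ih =>
    rw [ih, stirlingQuotient_eq_mul_exp (z := z + N) (by simp; positivity), Finset.sum_range_succ,
      mul_assoc, ← Complex.exp_add, Nat.cast_succ, add_assoc, add_comm (binetIncrement _)]

/-- From (t + k)² ≤ 2 |z + k|² and t + k + 1 ≤ 2 (t + k), valid since t ≥ 1, each term is at most a
third of the telescoping difference 1/(t + k) - 1/(t + k + 1). -/
lemma norm_sum_binetIncrement_le {z : ℂ} (hz : 0 < z.re) (h1 : 1 ≤ z.im) (N : ℕ) :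
    ‖∑ k ∈ Finset.range N, binetIncrement (z + k)‖ ≤ 1 / (3 * z.im) := by
  set t := z.im with ht
  have hstep : ∀ k : ℕ, ‖binetIncrement (z + k)‖ ≤ 1 / 3 * (1 / (t + k) - 1 / (t + (k + 1 : ℕ))) := by
    intro k
    have hre : 0 < (z + k).re := by simp; positivity
    refine (norm_binetIncrement_le hre).trans ?_
    have hk : (0 : ℝ) ≤ k := by positivity
    have hn : (t + k) ^ 2 ≤ 2 * ‖z + k‖ ^ 2 := by
      rw [Complex.sq_norm, Complex.normSq_apply]
      simp only [Complex.add_re, Complex.add_im, Complex.natCast_re, Complex.natCast_im, add_zero,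
        ← ht]
      nlinarith [sq_nonneg (t - k), mul_nonneg hz.le hk]
    have e : 1 / 3 * (1 / (t + k) - 1 / (t + (k + 1 : ℕ)))
        = 1 / (3 * ((t + k) * (t + k + 1))) := by
      push_cast
      field_simp
      ring
    rw [e]
    apply one_div_le_one_div_of_le (by positivity)
    nlinarith
  refine (norm_sum_le_of_le _ fun k _ => hstep k).trans ?_
  rw [← Finset.mul_sum, Finset.sum_range_sub' (fun k : ℕ => 1 / (t + (k : ℝ)))]
  have h2 : 0 ≤ 1 / (t + (N : ℝ)) := by positivity
  have h3 : 1 / (3 * t) = 1 / 3 * (1 / (t + ((0 : ℕ) : ℝ))) := by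
    rw [Nat.cast_zero, add_zero]; field_simp
  rw [h3]
  linarith

lemma Gamma_add_natCast_eq {z : ℂ} (hz : 0 < z.re) (N : ℕ) :
    Complex.Gamma (z + N) = (∏ j ∈ Finset.range N, (z + j)) * Complex.Gamma z := by
  induction N with
  | zero => simp
  | succ N ih =>
    have h0 : z + N ≠ 0 := fun h => by
      have := congrArg Complex.re h
      simp at this
      have h2 : (0 : ℝ) ≤ N := by positivity
      linarith
    rw [Nat.cast_succ, ← add_assoc, Complex.Gamma_add_one _ h0, ih, Finset.prod_range_succ]
    ring

/-- Euler's limit formula expresses Γ(z + N + 1) through N^z N!, and Stirling's formula for N!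
supplies the constant. -/
lemma tendsto_stirlingQuotient_add_natCast {z : ℂ} (hz : 0 < z.re) :
    Tendsto (fun N : ℕ => stirlingQuotient (z + N)) atTop (𝓝 (Real.sqrt (2 * Real.pi) : ℝ)) := by
  have hG : Complex.Gamma z ≠ 0 := Complex.Gamma_ne_zero_of_re_pos hz
  rw [← tendsto_add_atTop_iff_nat 1]
  have hlim : Tendsto (fun N : ℕ => Complex.Gamma z / Complex.GammaSeq z N
      * ((Stirling.stirlingSeq N : ℝ) : ℂ) * ((Real.sqrt 2 : ℝ) : ℂ)
      * Complex.exp (z + 1 - (N * Complex.log (1 + (z + 1) / N)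
        + (z + 1 / 2) * Complex.log (1 + (z + 1) / N)))) atTop
      (𝓝 (Complex.Gamma z / Complex.Gamma z * ((Real.sqrt Real.pi : ℝ) : ℂ)
        * ((Real.sqrt 2 : ℝ) : ℂ) * Complex.exp (z + 1 - (z + 1 + (z + 1 / 2) * 0)))) := by
    have h0 : Tendsto (fun N : ℕ => (z + 1) / (N : ℂ)) atTop (𝓝 0) :=
      tendsto_const_div_atTop_nhds_zero_nat (z + 1)
    have hlog : Tendsto (fun N : ℕ => Complex.log (1 + (z + 1) / (N : ℂ))) atTop (𝓝 0) := by
      have h1 : Tendsto (fun N : ℕ => 1 + (z + 1) / (N : ℂ)) atTop (𝓝 1) := by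
        simpa using h0.const_add 1
      simpa using h1.clog (by simp)
    refine (((tendsto_const_nhds.div (Complex.GammaSeq_tendsto_Gamma z) hG).mul
      ((Complex.continuous_ofReal.tendsto _).comp Stirling.tendsto_stirlingSeq_sqrt_pi)).mul
      tendsto_const_nhds).mul ?_
    refine (Complex.continuous_exp.tendsto _).comp (tendsto_const_nhds.sub (Tendsto.add ?_
      (tendsto_const_nhds.mul hlog)))
    refine Complex.tendsto_nat_mul_log_one_add_of_tendsto ?_
    refine tendsto_const_nhds.congr' ?_
    filter_upwards [eventually_gt_atTop 0] with N hN
    have : (N : ℂ) ≠ 0 := by exact_mod_cast hN.ne'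
    field_simp
  have hval : Complex.Gamma z / Complex.Gamma z * ((Real.sqrt Real.pi : ℝ) : ℂ)
        * ((Real.sqrt 2 : ℝ) : ℂ) * Complex.exp (z + 1 - (z + 1 + (z + 1 / 2) * 0))
        = ((Real.sqrt (2 * Real.pi) : ℝ) : ℂ) := by
    rw [div_self hG, Real.sqrt_mul (by norm_num)]
    simp
    ring
  rw [hval] at hlim
  refine hlim.congr' ?_
  filter_upwards [eventually_gt_atTop 0] with N hN
  have hNr : (0 : ℝ) < N := by exact_mod_cast hN
  have hNc : (N : ℂ) ≠ 0 := by exact_mod_cast hN.ne'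
  have hzN : ∀ j : ℕ, z + j ≠ 0 := fun j h => by
    have := congrArg Complex.re h
    simp at this
    have h2 : (0 : ℝ) ≤ j := by positivity
    linarith
  have hprod : ∏ j ∈ Finset.range (N + 1), (z + j) ≠ 0 := Finset.prod_ne_zero_iff.mpr
    fun j _ => hzN j
  have hlogN : Complex.log (z + (N + 1 : ℕ)) = Complex.log N + Complex.log (1 + (z + 1) / N) := by
    have h1 : z + (N + 1 : ℕ) = ((N : ℝ) : ℂ) * (1 + (z + 1) / N) := by
      push_cast; field_simp; ring
    have h2 : 1 + (z + 1) / (N : ℂ) ≠ 0 := by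
      intro h
      rw [h, mul_zero] at h1
      exact hzN _ h1
    rw [h1, Complex.log_ofReal_mul hNr h2, Complex.natCast_log]
  have hfact : ((N.factorial : ℕ) : ℂ) = ((Stirling.stirlingSeq N : ℝ) : ℂ) *
      ((Real.sqrt 2 : ℝ) : ℂ) * Complex.exp ((N + 1 / 2) * Complex.log N - N) := by
    have h1 : (N.factorial : ℝ) = Stirling.stirlingSeq N * Real.sqrt 2
        * Real.exp ((N + 1 / 2) * Real.log N - N) := by
      have h2 : Real.exp ((N + 1 / 2) * Real.log N - N)
          = Real.sqrt N * (N / Real.exp 1) ^ N := by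
        rw [Real.sqrt_eq_rpow, Real.rpow_def_of_pos hNr, div_pow, ← Real.exp_nat_mul, mul_one,
          ← Real.rpow_natCast, Real.rpow_def_of_pos hNr, ← mul_div_assoc, ← Real.exp_add,
          ← Real.exp_sub]
        congr 1
        ring
      rw [h2, Stirling.stirlingSeq, Real.sqrt_mul (by norm_num)]
      field_simp
    have h3 := congrArg (fun x : ℝ => (x : ℂ)) h1
    simp only [Complex.ofReal_mul, Complex.ofReal_exp, Complex.ofReal_sub, Complex.ofReal_add,
      Complex.ofReal_div, Complex.ofReal_one, Complex.ofReal_ofNat, Complex.ofReal_natCast,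
      Complex.natCast_log] at h3
    exact h3
  have hcpow : (N : ℂ) ^ z = Complex.exp (z * Complex.log N) := by
    rw [Complex.cpow_def_of_ne_zero hNc, mul_comm]
  have hGq : Complex.Gamma z / Complex.GammaSeq z N = Complex.Gamma (z + (N + 1 : ℕ))
      / ((N : ℂ) ^ z * N.factorial) := by
    rw [Gamma_add_natCast_eq hz, Complex.GammaSeq]
    field_simp
  have hS0 : ((Stirling.stirlingSeq N : ℝ) : ℂ) * ((Real.sqrt 2 : ℝ) : ℂ) ≠ 0 := by
    intro h
    rw [h, zero_mul] at hfact
    exact (Nat.cast_ne_zero.mpr N.factorial_ne_zero) hfact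
  have hcan : ∀ G a b A B X : ℂ, A * B ≠ 0 → G / (Complex.exp a * (A * B * Complex.exp b)) * A * B
      * X = G * (Complex.exp (-a - b) * X) := fun G a b A B X hAB => by
    have h1 := left_ne_zero_of_mul hAB
    have h2 := right_ne_zero_of_mul hAB
    rw [Complex.exp_sub, Complex.exp_neg]
    field_simp
  rw [hGq, hfact, hcpow, stirlingQuotient, hlogN, hcan _ _ _ _ _ _ hS0, ← Complex.exp_add]
  congr 2
  push_cast
  ring

lemma nearOne_stirlingQuotient {z : ℂ} (hz : 0 < z.re) (h1 : 1 ≤ z.im) :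
    NearOne (1 / (3 * z.im)) (stirlingQuotient z / (Real.sqrt (2 * Real.pi) : ℝ)) := by
  have hpi : ((Real.sqrt (2 * Real.pi) : ℝ) : ℂ) ≠ 0 := by
    have : 0 < Real.sqrt (2 * Real.pi) := Real.sqrt_pos.mpr (by positivity)
    exact_mod_cast this.ne'
  have hlim := (tendsto_const_nhds (x := stirlingQuotient z)).div
    (tendsto_stirlingQuotient_add_natCast hz) hpi
  refine le_of_tendsto (hlim.sub_const 1).norm (Eventually.of_forall fun N => ?_)
  have h0 : stirlingQuotient (z + N) ≠ 0 := by
    refine mul_ne_zero (Complex.Gamma_ne_zero_of_re_pos ?_) (Complex.exp_ne_zero _)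
    simp
    positivity
  have h2 : stirlingQuotient z / stirlingQuotient (z + N)
      = Complex.exp (∑ k ∈ Finset.range N, binetIncrement (z + k)) := by
    nth_rewrite 1 [stirlingQuotient_eq_mul_exp_sum hz N]
    rw [mul_div_cancel_left₀ _ h0]
  have h3 := (nearOne_exp (∑ k ∈ Finset.range N, binetIncrement (z + k))).mono
    (norm_sum_binetIncrement_le hz h1 N)
  simp only [Pi.div_apply, h2]
  exact h3

/-- Stirling's formula on vertical lines in the right half-plane, with an explicit error term. -/
lemma exists_Gamma_eq_mul_nearOne {β τ : ℝ} (hβ : 0 < β) (hβ' : β ≤ 7 / 4) (hτ : 1 ≤ τ) :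
    ∃ X : ℂ, NearOne (4.06 / τ) X ∧ Complex.Gamma (β + τ * Complex.I) =
      (Real.sqrt (2 * Real.pi) : ℝ) * Complex.exp ((β - 1 / 2 + τ * Complex.I)
        * (Real.log τ + Real.pi / 2 * Complex.I) - τ * Complex.I) * X := by
  set z : ℂ := β + τ * Complex.I with hz
  have hzre : z.re = β := by simp [hz]
  have hzim : z.im = τ := by simp [hz]
  have hτ0 : 0 < τ := by linarith
  have hτc : (τ : ℂ) ≠ 0 := by exact_mod_cast hτ0.ne'
  have hpi : ((Real.sqrt (2 * Real.pi) : ℝ) : ℂ) ≠ 0 := by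
    have : 0 < Real.sqrt (2 * Real.pi) := Real.sqrt_pos.mpr (by positivity)
    exact_mod_cast this.ne'
  have hS := nearOne_stirlingQuotient (z := z) (by rw [hzre]; exact hβ) (by rw [hzim]; exact hτ)
  rw [hzim] at hS
  have hlogI : Complex.log (τ * Complex.I) = Real.log τ + Real.pi / 2 * Complex.I := by
    rw [Complex.log_ofReal_mul hτ0 Complex.I_ne_zero, Complex.log_I]
  set ℓ : ℂ := Complex.log z - Complex.log (τ * Complex.I) with hℓ
  have hslit : ∀ v : ℝ, (v : ℂ) + τ * Complex.I ∈ Complex.slitPlane := fun v => by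
    right; simp; exact hτ0.ne'
  have hnorm : ∀ v : ℝ, τ ≤ ‖(v : ℂ) + τ * Complex.I‖ := fun v => by
    refine le_trans ?_ (Complex.abs_im_le_norm _)
    simp [abs_of_pos hτ0]
  have hdlog : ∀ v : ℝ, HasDerivAt (fun v : ℝ => Complex.log ((v : ℂ) + τ * Complex.I))
      (1 / ((v : ℂ) + τ * Complex.I)) v := fun v =>
    ((Complex.ofRealCLM.hasDerivAt (x := v)).add_const (τ * Complex.I)).clog_real (hslit v)
  have hℓ1 : ‖ℓ‖ ≤ β / τ := by
    have := norm_sub_le_of_norm_hasDerivAt_le hβ.le (fun v _ => hdlog v) (W := fun v => v / τ)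
      (W' := fun _ => 1 / τ) (fun v => (hasDerivAt_id v).div_const τ) (fun v _ => by
        rw [norm_div, norm_one]
        exact one_div_le_one_div_of_le hτ0 (hnorm v))
    simpa [hℓ, hz] using this
  have hℓ2 : ‖ℓ - β / (τ * Complex.I)‖ ≤ β ^ 2 / (2 * τ ^ 2) := by
    have := norm_sub_le_of_norm_hasDerivAt_le hβ.le (fun v _ => (hdlog v).sub
      ((Complex.ofRealCLM.hasDerivAt (x := v)).div_const (τ * Complex.I)))
      (W := fun v => v ^ 2 / (2 * τ ^ 2))
      (W' := fun v => v / τ ^ 2) (fun v => ((hasDerivAt_pow 2 v).div_const (2 * τ ^ 2)).congr_deriv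
        (by field_simp; norm_num)) (fun v hv => by
        have h1 : (v : ℂ) + τ * Complex.I ≠ 0 := Complex.slitPlane_ne_zero (hslit v)
        have h2 : 1 / ((v : ℂ) + τ * Complex.I) - Complex.ofRealCLM 1 / (τ * Complex.I)
            = -v / (((v : ℂ) + τ * Complex.I) * (τ * Complex.I)) := by
          have := Complex.I_ne_zero
          rw [Complex.ofRealCLM_apply, Complex.ofReal_one]
          field_simp
          ring
        rw [h2, norm_div, norm_neg, norm_mul, norm_mul, Complex.norm_I, mul_one, Complex.norm_real,
          Complex.norm_real, Real.norm_of_nonneg hv.1, Real.norm_of_nonneg hτ0.le, sq]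
        have := hnorm v
        have := hv.1
        gcongr)
    refine le_trans (le_of_eq ?_) (this.trans (le_of_eq ?_))
    · congr 1
      simp [hℓ, hz]
      ring
    · simp
  -- The error made in replacing log z by log(iτ). As ℓ ≈ β/(iτ), the product iτ ℓ cancels β to
  -- first order, so b = O(1/τ); the constant is 119/32 = (5/4)(7/4) + (7/4)²/2.
  set b : ℂ := (β - 1 / 2 + τ * Complex.I) * ℓ - β with hb
  have hbn : ‖b‖ ≤ 119 / 32 / τ := by
    have h1 : b = (β - 1 / 2) * ℓ + τ * Complex.I * (ℓ - β / (τ * Complex.I)) := by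
      have := Complex.I_ne_zero
      rw [hb]
      field_simp
      ring
    have h2 : ‖((β : ℂ) - 1 / 2)‖ ≤ 5 / 4 := by
      have : ((β : ℂ) - 1 / 2) = ((β - 1 / 2 : ℝ) : ℂ) := by push_cast; ring
      rw [this, Complex.norm_real, Real.norm_eq_abs, abs_le]
      constructor <;> linarith
    rw [h1]
    refine (norm_add_le _ _).trans ?_
    rw [norm_mul, norm_mul, norm_mul, Complex.norm_I, mul_one, Complex.norm_real,
      Real.norm_of_nonneg hτ0.le]
    calc ‖((β : ℂ) - 1 / 2)‖ * ‖ℓ‖ + τ * ‖ℓ - β / (τ * Complex.I)‖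
        ≤ 5 / 4 * ((7 / 4) / τ) + τ * ((7 / 4) ^ 2 / (2 * τ ^ 2)) := by
          have h3 : ‖ℓ‖ ≤ (7 / 4) / τ := hℓ1.trans (by gcongr)
          have h4 : ‖ℓ - β / (τ * Complex.I)‖ ≤ (7 / 4) ^ 2 / (2 * τ ^ 2) := hℓ2.trans (by gcongr)
          gcongr
      _ = 119 / 32 / τ := by field_simp; norm_num
  refine ⟨Complex.exp b * (stirlingQuotient z / (Real.sqrt (2 * Real.pi) : ℝ)), ?_, ?_⟩
  · refine (((nearOne_exp b).mono hbn).mul hS).mono ?_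
    have : 119 / 32 / τ + 1 / (3 * τ) = (119 / 32 + 1 / 3) / τ := by field_simp
    rw [this]
    gcongr
    norm_num
  · have hcan : ∀ A B C D : ℂ, A ≠ 0 → A * B * (C * (D / A)) = D * (B * C) := fun A B C D hA => by
      field_simp
    rw [hcan _ _ _ _ hpi, stirlingQuotient, mul_assoc, ← Complex.exp_add, ← Complex.exp_add]
    rw [← hlogI]
    have : z - (z - 1 / 2) * Complex.log z + ((β - 1 / 2 + τ * Complex.I) *
        Complex.log (τ * Complex.I) - τ * Complex.I + b) = 0 := by
      rw [hb, hℓ]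
      simp only [hz]
      ring
    rw [this, Complex.exp_zero, mul_one]

end Stirling

/-! ### The factor of the functional equation: reflection, asymptotics, bounds -/

section GammaFactors

open ComplexConjugate

/-- The factor `2 (2π)^(-z) cos(πz/2) Γ(z)` contributed by a real place. -/
def gCos (z : ℂ) : ℂ :=
  2 * ((2 * Real.pi : ℝ) : ℂ) ^ (-z) * Complex.cos (Real.pi * z / 2) * Complex.Gamma z

/-- The factor `2 (2π)^(-z) sin(πz/2) Γ(z)`; a complex place contributes `gCos z * gSin z`. -/
def gSin (z : ℂ) : ℂ :=
  2 * ((2 * Real.pi : ℝ) : ℂ) ^ (-z) * Complex.sin (Real.pi * z / 2) * Complex.Gamma z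

/-- The general shape of the factor in the functional equation. -/
def phi (p q : ℕ) (D : ℝ) (z : ℂ) : ℂ := (D : ℂ) ^ (z - 1 / 2) * gCos z ^ p * gSin z ^ q

lemma two_pi_ne_zero : ((2 * Real.pi : ℝ) : ℂ) ≠ 0 := by
  exact_mod_cast Real.two_pi_pos.ne'

/-- Euler's reflection formula Γ(s) Γ(1 - s) = π / sin(πs), shared by the cosine and sine factors: s
↦ 1 - s exchanges cos(πs/2) and sin(πs/2), so a and b play these two roles. -/
lemma mul_reflection_aux (s : ℂ) {a b : ℂ} (hs : Complex.sin (Real.pi * s) ≠ 0)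
    (hab : 2 * (a * b) = Complex.sin (Real.pi * s)) :
    (2 * ((2 * Real.pi : ℝ) : ℂ) ^ (-s) * a * Complex.Gamma s) *
      (2 * ((2 * Real.pi : ℝ) : ℂ) ^ (-(1 - s)) * b * Complex.Gamma (1 - s)) = 1 := by
  have h1 : ((2 * Real.pi : ℝ) : ℂ) ^ (-s) * ((2 * Real.pi : ℝ) : ℂ) ^ (-(1 - s))
      = (2 * (Real.pi : ℂ))⁻¹ := by
    rw [← Complex.cpow_add _ _ two_pi_ne_zero]
    have : -s + -(1 - s) = -1 := by ring
    rw [this, Complex.cpow_neg_one]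
    push_cast
    rfl
  have hpi : (Real.pi : ℂ) ≠ 0 := by exact_mod_cast Real.pi_ne_zero
  calc _ = 2 * (((2 * Real.pi : ℝ) : ℂ) ^ (-s) * ((2 * Real.pi : ℝ) : ℂ) ^ (-(1 - s)))
        * (2 * (a * b)) * (Complex.Gamma s * Complex.Gamma (1 - s)) := by ring
    _ = 1 := by
      rw [h1, hab, Complex.Gamma_mul_Gamma_one_sub]
      field_simp

lemma sin_pi_mul_eq (s : ℂ) : Complex.sin (Real.pi * s)
    = 2 * (Complex.sin (Real.pi * s / 2) * Complex.cos (Real.pi * s / 2)) := by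
  rw [← mul_assoc, ← Complex.sin_two_mul]
  congr 1
  ring

lemma cos_pi_mul_one_sub_div_two (s : ℂ) :
    Complex.cos (Real.pi * (1 - s) / 2) = Complex.sin (Real.pi * s / 2) := by
  rw [← Complex.cos_pi_div_two_sub]
  congr 1
  ring

lemma sin_pi_mul_one_sub_div_two (s : ℂ) :
    Complex.sin (Real.pi * (1 - s) / 2) = Complex.cos (Real.pi * s / 2) := by
  rw [← Complex.sin_pi_div_two_sub]
  congr 1
  ring

lemma gCos_mul_gCos_one_sub {s : ℂ} (hs : Complex.sin (Real.pi * s) ≠ 0) :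
    gCos s * gCos (1 - s) = 1 :=
  mul_reflection_aux s hs (by rw [cos_pi_mul_one_sub_div_two, sin_pi_mul_eq]; ring)

lemma gSin_mul_gSin_one_sub {s : ℂ} (hs : Complex.sin (Real.pi * s) ≠ 0) :
    gSin s * gSin (1 - s) = 1 :=
  mul_reflection_aux s hs (by rw [sin_pi_mul_one_sub_div_two, sin_pi_mul_eq])

lemma phi_mul_phi_one_sub (p q : ℕ) {D : ℝ} (hD : 0 < D) {s : ℂ}
    (hs : Complex.sin (Real.pi * s) ≠ 0) : phi p q D s * phi p q D (1 - s) = 1 := by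
  have hDc : (D : ℂ) ≠ 0 := by exact_mod_cast hD.ne'
  have h1 : (D : ℂ) ^ (s - 1 / 2) * (D : ℂ) ^ (1 - s - 1 / 2) = 1 := by
    rw [← Complex.cpow_add _ _ hDc]
    ring_nf
    simp
  calc _ = ((D : ℂ) ^ (s - 1 / 2) * (D : ℂ) ^ (1 - s - 1 / 2)) * (gCos s * gCos (1 - s)) ^ p
        * (gSin s * gSin (1 - s)) ^ q := by simp only [phi]; ring
    _ = 1 := by rw [h1, gCos_mul_gCos_one_sub hs, gSin_mul_gSin_one_sub hs]; simp

lemma gCos_one : gCos 1 = 0 := by simp [gCos]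

lemma phi_one {p : ℕ} (hp : p ≠ 0) (q : ℕ) (D : ℝ) : phi p q D 1 = 0 := by
  simp [phi, gCos_one, hp]

lemma ofReal_cpow_conj {x : ℝ} (hx : 0 < x) (z : ℂ) :
    (x : ℂ) ^ conj z = conj ((x : ℂ) ^ z) := by
  rw [Complex.cpow_conj _ _ (by rw [Complex.arg_ofReal_of_nonneg hx.le]; exact Real.pi_pos.ne),
    Complex.conj_ofReal]

lemma gCos_conj (z : ℂ) : gCos (conj z) = conj (gCos z) := by
  simp only [gCos, map_mul, ← ofReal_cpow_conj Real.two_pi_pos, ← Complex.Gamma_conj,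
    ← Complex.cos_conj, map_div₀, Complex.conj_ofReal, map_ofNat, map_neg]

lemma gSin_conj (z : ℂ) : gSin (conj z) = conj (gSin z) := by
  simp only [gSin, map_mul, ← ofReal_cpow_conj Real.two_pi_pos, ← Complex.Gamma_conj,
    ← Complex.sin_conj, map_div₀, Complex.conj_ofReal, map_ofNat, map_neg]

lemma phi_conj (p q : ℕ) {D : ℝ} (hD : 0 < D) (z : ℂ) : phi p q D (conj z) = conj (phi p q D z) := by
  simp only [phi, map_mul, map_pow, gCos_conj, gSin_conj, ← ofReal_cpow_conj hD, map_sub, map_div₀,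
    map_one, map_ofNat]

lemma differentiableAt_Gamma_of_re_pos {z : ℂ} (hz : 0 < z.re) :
    DifferentiableAt ℂ Complex.Gamma z := by
  refine Complex.differentiableAt_Gamma _ fun m hm => ?_
  rw [hm] at hz
  simp at hz
  have : (0 : ℝ) ≤ m := by positivity
  linarith

lemma differentiableAt_phi (p q : ℕ) {D : ℝ} (hD : 0 < D) {z : ℂ} (hz : 0 < z.re) :
    DifferentiableAt ℂ (phi p q D) z := by
  have hDc : (D : ℂ) ≠ 0 := by exact_mod_cast hD.ne'
  have h1 := differentiableAt_Gamma_of_re_pos hz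
  have h2 : DifferentiableAt ℂ (fun z : ℂ => ((2 * Real.pi : ℝ) : ℂ) ^ (-z)) z :=
    differentiableAt_id.neg.const_cpow (Or.inl two_pi_ne_zero)
  have h3 : DifferentiableAt ℂ (fun z : ℂ => (D : ℂ) ^ (z - 1 / 2)) z :=
    (differentiableAt_id.sub_const _).const_cpow (Or.inl hDc)
  unfold phi gCos gSin
  fun_prop

/-- The main term in the asymptotic formula for `gCos` and `gSin`. -/
def mainTerm (β τ : ℝ) : ℂ :=
  Complex.exp (((1 / 2 - β) * Real.log (2 * Real.pi) + (β - 1 / 2) * Real.log τ : ℝ)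
    + Complex.I * (τ * (Real.log τ - Real.log (2 * Real.pi)) - τ : ℝ))

lemma nearOne_one_add {τ : ℝ} (hτ : 1 ≤ τ) {y : ℂ} (hy : ‖y‖ ≤ Real.exp (-(Real.pi * τ))) :
    NearOne (1 / (3 * τ)) (1 + y) := by
  have hpt : 3 * τ ≤ Real.exp (Real.pi * τ) := by
    have h1 := Real.add_one_le_exp (Real.pi * τ)
    nlinarith [Real.pi_gt_three]
  unfold NearOne
  rw [add_sub_cancel_left]
  refine hy.trans ?_
  rw [Real.exp_neg, ← one_div]
  have h2 := Real.add_one_le_exp (1 / (3 * τ))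
  have h3 := one_div_le_one_div_of_le (by positivity) hpt
  linarith

/-- The growth e^(πτ/2) of exp(-iπz/2) cancels the decay of Γ. Here y stands for ±exp(iπz), the
ratio of the smaller to the larger exponential in the cosine or sine. -/
lemma exists_mul_Gamma_eq_mainTerm_mul {β τ : ℝ} (hβ : 0 < β) (hβ' : β ≤ 7 / 4) (hτ : 1 ≤ τ)
    {y : ℂ} (hy : ‖y‖ ≤ Real.exp (-(Real.pi * τ))) :
    ∃ X : ℂ, NearOne (4.4 / τ) X ∧
      ((2 * Real.pi : ℝ) : ℂ) ^ (-(β + τ * Complex.I))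
        * (Complex.exp (-(Real.pi * (β + τ * Complex.I) / 2 * Complex.I)) * (1 + y))
        * Complex.Gamma (β + τ * Complex.I)
      = Complex.exp (-(Real.pi / 4 * Complex.I)) * mainTerm β τ * X := by
  obtain ⟨X, hX, hG⟩ := exists_Gamma_eq_mul_nearOne hβ hβ' hτ
  refine ⟨(1 + y) * X, ((nearOne_one_add hτ hy).mul hX).mono ?_, ?_⟩
  · have : 1 / (3 * τ) + 4.06 / τ = (1 / 3 + 4.06) / τ := by field_simp
    rw [this]
    gcongr
    norm_num
  · have hs : ((Real.sqrt (2 * Real.pi) : ℝ) : ℂ)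
        = Complex.exp ((Real.log (2 * Real.pi) : ℝ) / 2) := by
      rw [Real.sqrt_eq_rpow, Real.rpow_def_of_pos Real.two_pi_pos]
      push_cast
      congr 1
      ring
    rw [hG, hs, Complex.cpow_def_of_ne_zero two_pi_ne_zero, ← Complex.ofReal_log Real.two_pi_pos.le,
      mainTerm]
    have hcan : ∀ a b c d e f : ℂ, a + b + c + d = e + f →
        Complex.exp a * (Complex.exp b * (1 + y)) * (Complex.exp c * Complex.exp d * X)
        = Complex.exp e * Complex.exp f * ((1 + y) * X) := fun a b c d e f h => by
      have h2 : Complex.exp a * Complex.exp b * Complex.exp c * Complex.exp d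
          = Complex.exp e * Complex.exp f := by
        rw [← Complex.exp_add, ← Complex.exp_add, ← Complex.exp_add, ← Complex.exp_add, h]
      rw [← h2]
      ring
    apply hcan
    push_cast
    linear_combination (-((Real.pi : ℂ) * τ / 2) + τ * (Real.pi / 2)) * Complex.I_sq

lemma norm_exp_pi_mul_I (β τ : ℝ) : ‖Complex.exp (Real.pi * (β + τ * Complex.I) * Complex.I)‖
    = Real.exp (-(Real.pi * τ)) := by
  rw [Complex.norm_exp]
  simp

lemma exists_gCos_eq {β τ : ℝ} (hβ : 0 < β) (hβ' : β ≤ 7 / 4) (hτ : 1 ≤ τ) :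
    ∃ X : ℂ, NearOne (4.4 / τ) X ∧ gCos (β + τ * Complex.I)
      = Complex.exp (-(Real.pi / 4 * Complex.I)) * mainTerm β τ * X := by
  obtain ⟨X, hX, h⟩ := exists_mul_Gamma_eq_mainTerm_mul hβ hβ' hτ (norm_exp_pi_mul_I β τ).le
  refine ⟨X, hX, ?_⟩
  rw [← h, gCos, Complex.cos]
  have h1 : Complex.exp (Real.pi * (β + τ * Complex.I) / 2 * Complex.I)
      = Complex.exp (-(Real.pi * (β + τ * Complex.I) / 2 * Complex.I))
        * Complex.exp (Real.pi * (β + τ * Complex.I) * Complex.I) := by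
    rw [← Complex.exp_add]; congr 1; ring
  rw [h1, neg_mul]
  ring

lemma exists_gSin_eq {β τ : ℝ} (hβ : 0 < β) (hβ' : β ≤ 7 / 4) (hτ : 1 ≤ τ) :
    ∃ X : ℂ, NearOne (4.4 / τ) X ∧ gSin (β + τ * Complex.I)
      = Complex.I * Complex.exp (-(Real.pi / 4 * Complex.I)) * mainTerm β τ * X := by
  obtain ⟨X, hX, h⟩ := exists_mul_Gamma_eq_mainTerm_mul hβ hβ' hτ
    (y := -Complex.exp (Real.pi * (β + τ * Complex.I) * Complex.I))
    (by rw [norm_neg]; exact (norm_exp_pi_mul_I β τ).le)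
  refine ⟨X, hX, ?_⟩
  rw [mul_assoc Complex.I, mul_assoc Complex.I, ← h, gSin, Complex.sin]
  have h1 : Complex.exp (Real.pi * (β + τ * Complex.I) / 2 * Complex.I)
      = Complex.exp (-(Real.pi * (β + τ * Complex.I) / 2 * Complex.I))
        * Complex.exp (Real.pi * (β + τ * Complex.I) * Complex.I) := by
    rw [← Complex.exp_add]; congr 1; ring
  rw [h1, neg_mul]
  ring

lemma norm_exp_neg_pi_div_four_mul_I : ‖Complex.exp (-(Real.pi / 4 * Complex.I))‖ = 1 := by
  have : -((Real.pi : ℂ) / 4 * Complex.I) = ((-(Real.pi / 4) : ℝ) : ℂ) * Complex.I := by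
    push_cast; ring
  rw [this, Complex.norm_exp_ofReal_mul_I]

/-- The asymptotic formula for `phi`, with a unimodular constant `c` that does not depend on `τ`. -/
lemma exists_phi_eq (p q : ℕ) {D : ℝ} (hD : 0 < D) (hpq : p + q ≠ 0) : ∃ c : ℂ, ‖c‖ = 1 ∧
    ∀ β τ : ℝ, 0 < β → β ≤ 7 / 4 → 1 ≤ τ → ∃ X : ℂ, NearOne (4.4 * (p + q : ℕ) / τ) X ∧
      phi p q D (β + τ * Complex.I) = c *
        ((D ^ (β - 1 / 2) * (2 * Real.pi) ^ ((p + q : ℕ) * (1 / 2 - β))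
          * τ ^ ((p + q : ℕ) * (β - 1 / 2)) : ℝ) : ℂ) *
        Complex.exp (Complex.I * (((p + q : ℕ) * (τ * (Real.log τ -
          (Real.log (2 * Real.pi) - Real.log D / (p + q : ℕ))) - τ) : ℝ) : ℂ)) * X := by
  refine ⟨Complex.exp (-(Real.pi / 4 * Complex.I)) ^ p *
    (Complex.I * Complex.exp (-(Real.pi / 4 * Complex.I))) ^ q, ?_, ?_⟩
  · simp only [norm_mul, norm_pow, norm_exp_neg_pi_div_four_mul_I, Complex.norm_I]
    simp
  intro β τ hβ hβ' hτ
  obtain ⟨X, hX, h1⟩ := exists_gCos_eq hβ hβ' hτ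
  obtain ⟨Y, hY, h2⟩ := exists_gSin_eq hβ hβ' hτ
  have hDc : (D : ℂ) ≠ 0 := by exact_mod_cast hD.ne'
  have hn : ((p + q : ℕ) : ℝ) ≠ 0 := by exact_mod_cast hpq
  have hτ0 : 0 < τ := by linarith
  refine ⟨X ^ p * Y ^ q, ((hX.pow p).mul (hY.pow q)).mono (le_of_eq ?_), ?_⟩
  · push_cast; ring
  · rw [phi, h1, h2]
    have h3 : (D : ℂ) ^ ((β + τ * Complex.I) - 1 / 2) * mainTerm β τ ^ (p + q)
        = ((D ^ (β - 1 / 2) * (2 * Real.pi) ^ ((p + q : ℕ) * (1 / 2 - β))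
          * τ ^ ((p + q : ℕ) * (β - 1 / 2)) : ℝ) : ℂ) *
        Complex.exp (Complex.I * (((p + q : ℕ) * (τ * (Real.log τ -
          (Real.log (2 * Real.pi) - Real.log D / (p + q : ℕ))) - τ) : ℝ) : ℂ)) := by
      rw [Real.rpow_def_of_pos hD, Real.rpow_def_of_pos Real.two_pi_pos, Real.rpow_def_of_pos hτ0,
        ← Real.exp_add, ← Real.exp_add, Complex.ofReal_exp, ← Complex.exp_add, mainTerm,
        ← Complex.exp_nat_mul, Complex.cpow_def_of_ne_zero hDc, ← Complex.exp_add,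
        ← Complex.ofReal_log hD.le]
      congr 1
      have hnc : ((p : ℂ) + q) ≠ 0 := by exact_mod_cast hpq
      push_cast
      field_simp
      ring
    rw [mul_assoc (_ ^ p * _ ^ q), ← h3]
    ring

/-- Only the order of growth matters here, for absolute convergence and for shifting lines;
`phi_conj` transfers it to the lower half-plane. -/
lemma norm_phi_le (p q : ℕ) {D : ℝ} (hD : 0 < D) (hpq : p + q ≠ 0) : ∃ C : ℝ, 0 < C ∧
    ∀ β τ : ℝ, 1 / 4 ≤ β → β ≤ 7 / 4 → 1 ≤ |τ| →
      ‖phi p q D (β + τ * Complex.I)‖ ≤ C * |τ| ^ ((p + q : ℕ) * (β - 1 / 2)) := by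
  obtain ⟨c, hc, h⟩ := exists_phi_eq p q hD hpq
  have hpos : ∃ C : ℝ, 0 < C ∧
    ∀ β τ : ℝ, 1 / 4 ≤ β → β ≤ 7 / 4 → 1 ≤ τ →
      ‖phi p q D (β + τ * Complex.I)‖ ≤ C * τ ^ ((p + q : ℕ) * (β - 1 / 2)) := by
    refine ⟨Real.exp (2 * |Real.log D|) * (2 * Real.pi) ^ ((p + q : ℕ) : ℝ)
      * Real.exp (4.4 * (p + q : ℕ)), by positivity, ?_⟩
    intro β τ hβ hβ' hτ
    obtain ⟨X, hX, h1⟩ := h β τ (by linarith) hβ' hτ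
    have hτ0 : 0 < τ := by linarith
    have hphase : ∀ r : ℝ, ‖Complex.exp (Complex.I * (r : ℂ))‖ = 1 := fun r => by
      rw [mul_comm, Complex.norm_exp_ofReal_mul_I]
    rw [h1, norm_mul, norm_mul, norm_mul, hc, hphase, Complex.norm_real,
      Real.norm_of_nonneg (by positivity), one_mul, mul_one]
    have e1 : D ^ (β - 1 / 2) ≤ Real.exp (2 * |Real.log D|) := by
      rw [Real.rpow_def_of_pos hD]
      apply Real.exp_le_exp.mpr
      have h2 : |β - 1 / 2| ≤ 2 := by rw [abs_le]; constructor <;> linarith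
      calc Real.log D * (β - 1 / 2) ≤ |Real.log D * (β - 1 / 2)| := le_abs_self _
        _ = |β - 1 / 2| * |Real.log D| := by rw [abs_mul, mul_comm]
        _ ≤ _ := by gcongr
    have e2 : (2 * Real.pi) ^ ((p + q : ℕ) * (1 / 2 - β)) ≤ (2 * Real.pi) ^ ((p + q : ℕ) : ℝ) := by
      apply Real.rpow_le_rpow_of_exponent_le (by linarith [Real.pi_gt_three])
      have : (0 : ℝ) ≤ (p + q : ℕ) := by positivity
      nlinarith
    have e3 : ‖X‖ ≤ Real.exp (4.4 * (p + q : ℕ)) := by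
      refine hX.norm_le.trans ?_
      gcongr
      exact div_le_self (by positivity) hτ
    calc _ ≤ Real.exp (2 * |Real.log D|) * (2 * Real.pi) ^ ((p + q : ℕ) : ℝ)
        * τ ^ ((p + q : ℕ) * (β - 1 / 2)) * Real.exp (4.4 * (p + q : ℕ)) := by gcongr
      _ = _ := by ring
  obtain ⟨C, hC, h1⟩ := hpos
  refine ⟨C, hC, fun β τ hβ hβ' hτ => ?_⟩
  rcases le_total 0 τ with h0 | h0
  · rw [abs_of_nonneg h0] at hτ ⊢
    exact h1 β τ hβ hβ' hτ
  · rw [abs_of_nonpos h0] at hτ ⊢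
    have h2 := h1 β (-τ) hβ hβ' hτ
    have h3 : (β : ℂ) + τ * Complex.I = conj ((β : ℂ) + (-τ : ℝ) * Complex.I) := by simp
    rwa [h3, phi_conj _ _ hD, Complex.norm_conj]

lemma Gamma_le_two {β : ℝ} (h1 : 1 / 2 ≤ β) (h2 : β ≤ 2) : Real.Gamma β ≤ 2 := by
  have h := Real.convexOn_Gamma.le_max_of_mem_Icc (x := 1 / 2) (y := 2) (z := β) (by simp)
    (by simp) ⟨h1, h2⟩
  refine h.trans (max_le ?_ ?_)
  · rw [Real.Gamma_one_half_eq, Real.sqrt_le_left (by norm_num)]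
    linarith [Real.pi_lt_four]
  · rw [Real.Gamma_two]; norm_num

lemma norm_Gamma_le_Gamma_re {z : ℂ} (hz : 0 < z.re) : ‖Complex.Gamma z‖ ≤ Real.Gamma z.re := by
  rw [Complex.Gamma_eq_integral hz, Real.Gamma_eq_integral hz, Complex.GammaIntegral]
  refine (MeasureTheory.norm_integral_le_integral_norm _).trans (le_of_eq ?_)
  refine MeasureTheory.setIntegral_congr_fun measurableSet_Ioi fun x hx => ?_
  have hx : 0 < x := hx
  rw [norm_mul, Complex.norm_real, Real.norm_of_nonneg (by positivity),
    Complex.norm_cpow_eq_rpow_re_of_pos hx]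
  simp

lemma exp_pi_div_two_le : Real.exp (Real.pi / 2) ≤ 5 := by
  have h1 : Real.pi / 2 ≤ (8 / 5 : ℝ) := by linarith [Real.pi_lt_d2]
  refine (Real.exp_le_exp.mpr h1).trans ?_
  have h2 : Real.exp (8 / 5) ^ 5 = Real.exp 1 ^ 8 := by
    rw [← Real.exp_nat_mul, ← Real.exp_nat_mul]; norm_num
  have h3 : Real.exp 1 ^ 8 ≤ 2.7182818286 ^ 8 := by
    gcongr
    exact Real.exp_one_lt_d9.le
  have h4 : Real.exp (8 / 5) ^ 5 ≤ 5 ^ 5 := by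
    rw [h2]
    exact h3.trans (by norm_num)
  exact le_of_pow_le_pow_left₀ (by norm_num) (by norm_num) h4

lemma norm_mul_Gamma_le_ten {β τ : ℝ} (h1 : 1 / 2 ≤ β) (h2 : β ≤ 2) {y : ℂ}
    (hy : ‖y‖ ≤ 5) :
    ‖2 * ((2 * Real.pi : ℝ) : ℂ) ^ (-((β : ℂ) + τ * Complex.I)) * y
      * Complex.Gamma (β + τ * Complex.I)‖ ≤ 10 := by
  have hΓ : ‖Complex.Gamma (β + τ * Complex.I)‖ ≤ 2 := by
    refine (norm_Gamma_le_Gamma_re (by simp; linarith)).trans ?_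
    simpa using Gamma_le_two h1 h2
  have hpow : ‖((2 * Real.pi : ℝ) : ℂ) ^ (-((β : ℂ) + τ * Complex.I))‖ ≤ 1 / 2 := by
    rw [Complex.norm_cpow_eq_rpow_re_of_pos Real.two_pi_pos]
    have h4 : (2 * Real.pi) ^ (-((β : ℂ) + τ * Complex.I)).re ≤ (2 * Real.pi) ^ (-(1 / 2) : ℝ) := by
      apply Real.rpow_le_rpow_of_exponent_le (by linarith [Real.pi_gt_three])
      simpa using h1
    refine h4.trans ?_
    rw [Real.rpow_neg Real.two_pi_pos.le, ← Real.sqrt_eq_rpow, one_div]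
    gcongr
    apply Real.le_sqrt_of_sq_le
    linarith [Real.pi_gt_three]
  rw [norm_mul, norm_mul, norm_mul, Complex.norm_ofNat]
  calc _ ≤ (2 : ℝ) * (1 / 2) * 5 * 2 := by gcongr
    _ = 10 := by norm_num

lemma norm_exp_div_two_le_five (β : ℝ) {τ : ℝ} (h : |τ| ≤ 1) {ε : ℝ} (hε : |ε| ≤ 1) :
    ‖Complex.exp (ε * (Real.pi * (β + τ * Complex.I) / 2 * Complex.I))‖ ≤ 5 := by
  rw [Complex.norm_exp]
  refine le_trans (Real.exp_le_exp.mpr ?_) exp_pi_div_two_le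
  have h1 : ((ε : ℂ) * (Real.pi * (β + τ * Complex.I) / 2 * Complex.I))
      = ((-(ε * τ) * (Real.pi / 2) : ℝ) : ℂ) + ((ε * Real.pi * β / 2 : ℝ) : ℂ) * Complex.I := by
    push_cast
    linear_combination ((ε : ℂ) * Real.pi * τ / 2) * Complex.I_sq
  rw [h1]
  simp only [Complex.add_re, Complex.ofReal_re, Complex.re_ofReal_mul, Complex.I_re, mul_zero,
    add_zero]
  have h2 : |ε * τ| ≤ 1 := by rw [abs_mul]; exact mul_le_one₀ hε (abs_nonneg _) h
  have h3 : -(ε * τ) ≤ 1 := by linarith [neg_abs_le (ε * τ)]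
  nlinarith [Real.pi_pos]

/-- Near the real axis, where the asymptotics are not used, |Γ(z)| ≤ Γ(Re z) ≤ 2 and e^(π/2) ≤ 5
bound each factor by 2 · (1/2) · 5 · 2 = 10. -/
lemma norm_phi_le_of_abs_le_one (p q : ℕ) {D : ℝ} (hD : 0 < D) {β τ : ℝ} (h1 : 1 / 2 ≤ β)
    (h2 : β ≤ 2) (hτ : |τ| ≤ 1) :
    ‖phi p q D (β + τ * Complex.I)‖ ≤ D ^ (β - 1 / 2) * 10 ^ (p + q) := by
  have ea := norm_exp_div_two_le_five β hτ (ε := 1) (by simp)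
  have eb := norm_exp_div_two_le_five β hτ (ε := -1) (by simp)
  rw [Complex.ofReal_one, one_mul] at ea
  rw [Complex.ofReal_neg, Complex.ofReal_one, neg_one_mul, ← neg_mul] at eb
  have hc : ‖gCos (β + τ * Complex.I)‖ ≤ 10 := by
    refine norm_mul_Gamma_le_ten h1 h2 ?_
    rw [Complex.cos, norm_div, Complex.norm_ofNat, div_le_iff₀ (by norm_num)]
    exact (norm_add_le _ _).trans (by linarith)
  have hs : ‖gSin (β + τ * Complex.I)‖ ≤ 10 := by
    refine norm_mul_Gamma_le_ten h1 h2 ?_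
    rw [Complex.sin, norm_div, Complex.norm_ofNat, div_le_iff₀ (by norm_num), norm_mul,
      Complex.norm_I, mul_one]
    exact (norm_sub_le _ _).trans (by linarith)
  rw [phi, norm_mul, norm_mul, norm_pow, norm_pow, Complex.norm_cpow_eq_rpow_re_of_pos hD, pow_add,
    ← mul_assoc]
  have hre : ((β : ℂ) + τ * Complex.I - 1 / 2).re = β - 1 / 2 := by simp
  rw [hre]
  gcongr

end GammaFactors

/-! ### Contour integrals: shifting the line and differentiating in w -/

section MellinIntegrals

open ComplexConjugate MeasureTheory

/-- `phi (1 - s) / s`, with its removable singularity at `0` removed. -/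
def phiQuotient (p q : ℕ) (D : ℝ) : ℂ → ℂ := dslope (fun s => phi p q D (1 - s)) 0

/-- The integrand `w^(s+m) / (s (s+1) ⋯ (s+m)) · phi (1 - s)`, with its removable singularity at
`0` removed. -/
def mellinIntegrand (p q : ℕ) (D : ℝ) (m : ℕ) (w : ℝ) (s : ℂ) : ℂ :=
  (w : ℂ) ^ (s + m) * (phiQuotient p q D s / ∏ j ∈ Finset.range m, (s + (j + 1 : ℕ)))

section Integrand

variable {p q : ℕ} {D : ℝ}

lemma phiQuotient_of_ne_zero (hp : p ≠ 0) {s : ℂ} (hs : s ≠ 0) :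
    phiQuotient p q D s = phi p q D (1 - s) / s := by
  rw [phiQuotient, dslope_of_ne _ hs, slope_def_field]
  simp [phi_one hp]

lemma mellinIntegrand_of_ne_zero (hp : p ≠ 0) (m : ℕ) (w : ℝ) {s : ℂ} (hs : s ≠ 0) :
    mellinIntegrand p q D m w s = (w : ℂ) ^ (s + m) / (∏ j ∈ Finset.range (m + 1), (s + j))
      * phi p q D (1 - s) := by
  rw [mellinIntegrand, phiQuotient_of_ne_zero hp hs, Finset.prod_range_succ']
  simp only [Nat.cast_zero, add_zero]
  rw [div_div, div_mul_eq_mul_div, mul_div_assoc, mul_comm s]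

lemma isOpen_re_lt_one : IsOpen {s : ℂ | s.re < 1} :=
  isOpen_lt Complex.continuous_re continuous_const

lemma differentiableAt_phiQuotient (hD : 0 < D) {s : ℂ} (hs : s.re < 1) :
    DifferentiableAt ℂ (phiQuotient p q D) s := by
  have h : DifferentiableOn ℂ (phiQuotient p q D) {s : ℂ | s.re < 1} := by
    rw [phiQuotient, Complex.differentiableOn_dslope (isOpen_re_lt_one.mem_nhds (by simp))]
    intro z hz
    have hz : z.re < 1 := hz
    have h1 := differentiableAt_phi p q hD (z := 1 - z) (by simp; exact hz)
    exact (h1.comp z (differentiableAt_id.const_sub 1)).differentiableWithinAt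
  exact h.differentiableAt (isOpen_re_lt_one.mem_nhds hs)

lemma prod_add_natCast_succ_ne_zero (m : ℕ) {s : ℂ} (hs : -1 < s.re) :
    ∏ j ∈ Finset.range m, (s + (j + 1 : ℕ)) ≠ 0 := by
  refine Finset.prod_ne_zero_iff.mpr fun j _ h => ?_
  have := congrArg Complex.re h
  simp at this
  have h2 : (0 : ℝ) ≤ j := by positivity
  linarith

lemma differentiableAt_mellinIntegrand (hD : 0 < D) (m : ℕ) {w : ℝ} (hw : 0 < w) {s : ℂ}
    (hs : -1 < s.re) (hs' : s.re < 1) : DifferentiableAt ℂ (mellinIntegrand p q D m w) s := by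
  have hwc : (w : ℂ) ≠ 0 := by exact_mod_cast hw.ne'
  have h1 := differentiableAt_phiQuotient (p := p) (q := q) hD hs'
  have h2 : DifferentiableAt ℂ (fun s : ℂ => (w : ℂ) ^ (s + m)) s :=
    (differentiableAt_id.add_const _).const_cpow (Or.inl hwc)
  have h3 : DifferentiableAt ℂ (fun s : ℂ => ∏ j ∈ Finset.range m, (s + (j + 1 : ℕ))) s := by
    fun_prop
  exact h2.mul (h1.div h3 (prod_add_natCast_succ_ne_zero m hs))

/-- Each of the m + 1 factors s + j has imaginary part t, hence modulus at least |t|. Uniformity in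
σ is what the horizontal sides of the contour require. -/
lemma norm_phiQuotient_div_le (hD : 0 < D) (hp : p ≠ 0) : ∃ C : ℝ, 0 < C ∧
    ∀ (m : ℕ) (σ t : ℝ), -(3 / 4) ≤ σ → σ ≤ 3 / 4 → 1 ≤ |t| →
      ‖phiQuotient p q D (σ + t * Complex.I) /
        ∏ j ∈ Finset.range m, ((σ + t * Complex.I) + (j + 1 : ℕ))‖
        ≤ C * |t| ^ ((p + q : ℕ) * (1 / 2 - σ) - 1 - m) := by
  obtain ⟨C, hC, h⟩ := norm_phi_le p q hD (by omega)
  refine ⟨C, hC, fun m σ t h1 h2 ht => ?_⟩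
  have ht0 : 0 < |t| := by linarith
  have him : ∀ s : ℂ, s.im = t → |t| ≤ ‖s‖ := fun s hs => hs ▸ Complex.abs_im_le_norm s
  have hs0 : (σ : ℂ) + t * Complex.I ≠ 0 := by
    rw [← norm_pos_iff]
    exact ht0.trans_le (him _ (by simp))
  have hprod : |t| ^ m ≤ ‖∏ j ∈ Finset.range m, ((σ + t * Complex.I) + ((j + 1 : ℕ) : ℂ))‖ := by
    rw [norm_prod]
    have := Finset.prod_le_prod (s := Finset.range m) (f := fun _ => |t|)
      (g := fun j => ‖(σ + t * Complex.I) + ((j + 1 : ℕ) : ℂ)‖) (fun _ _ => ht0.le)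
      (fun j _ => him _ (by simp))
    simpa using this
  have hphi : ‖phi p q D (1 - (σ + t * Complex.I))‖ ≤ C * |t| ^ ((p + q : ℕ) * (1 / 2 - σ)) := by
    have h3 := h (1 - σ) (-t) (by linarith) (by linarith) (by rwa [abs_neg])
    rw [abs_neg] at h3
    convert h3 using 3
    · push_cast; ring
    · ring
  rw [phiQuotient_of_ne_zero hp hs0, norm_div, norm_div, div_div,
    Real.rpow_sub ht0, Real.rpow_sub ht0, Real.rpow_one, Real.rpow_natCast, div_div,
    ← mul_div_assoc]
  gcongr
  exact him _ (by simp)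

lemma norm_mellinIntegrand (m : ℕ) {w : ℝ} (hw : 0 < w) (s : ℂ) :
    ‖mellinIntegrand p q D m w s‖ = w ^ (s.re + m) *
      ‖phiQuotient p q D s / ∏ j ∈ Finset.range m, (s + (j + 1 : ℕ))‖ := by
  rw [mellinIntegrand, norm_mul, Complex.norm_cpow_eq_rpow_re_of_pos hw]
  simp

end Integrand

lemma tendsto_rpow_neg_half : Tendsto (fun x : ℝ => x ^ (-(1 / 2) : ℝ)) atTop (𝓝 0) :=
  tendsto_rpow_neg_atTop (by norm_num)

/-- Shifting the line of integration to the left. -/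
lemma HasVerticalIntegral.shift_left {F : ℂ → ℂ} {c d C : ℝ} {I : ℂ} (hcd : c ≤ d)
    (hF : ∀ s : ℂ, c ≤ s.re → s.re ≤ d → DifferentiableAt ℂ F s)
    (hbound : ∀ x t : ℝ, c ≤ x → x ≤ d → 1 ≤ |t| →
      ‖F (x + t * Complex.I)‖ ≤ C * |t| ^ (-(1 / 2) : ℝ))
    (h : HasVerticalIntegral F d I) : HasVerticalIntegral F c I := by
  have hside : ∀ t : ℝ, 1 ≤ |t| → ‖∫ x in c..d, F (x + t * Complex.I)‖
      ≤ C * |t| ^ (-(1 / 2) : ℝ) * |d - c| := fun t ht =>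
    intervalIntegral.norm_integral_le_of_norm_le_const fun x hx => by
      rw [Set.uIoc_of_le hcd] at hx
      exact hbound x t hx.1.le hx.2 ht
  have hdiff : ∀ a b : ℝ, truncatedVerticalIntegral F c a b = truncatedVerticalIntegral F d a b +
      (2 * (Real.pi : ℂ) * Complex.I)⁻¹ * ((∫ x in c..d, F (x + (-a : ℝ) * Complex.I))
        - ∫ x in c..d, F (x + b * Complex.I)) := by
    intro a b
    have hrect := Complex.integral_boundary_rect_eq_zero_of_differentiableOn F
      (c + (-a : ℝ) * Complex.I) (d + b * Complex.I) (fun s hs => by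
        have h1 := hs.1
        simp [Set.uIcc_of_le hcd] at h1
        exact (hF s h1.1 h1.2).differentiableWithinAt)
    simp only [Complex.add_re, Complex.add_im, Complex.ofReal_re, Complex.ofReal_im,
      Complex.re_ofReal_mul, Complex.im_ofReal_mul, Complex.I_re, Complex.I_im, mul_zero, mul_one,
      add_zero, zero_add, smul_eq_mul] at hrect
    simp only [truncatedVerticalIntegral, intervalIntegral.integral_mul_const]
    linear_combination (-(2 * (Real.pi : ℂ) * Complex.I)⁻¹) * hrect
  have hzero : Tendsto (fun r : ℝ × ℝ => (2 * (Real.pi : ℂ) * Complex.I)⁻¹ *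
      ((∫ x in c..d, F (x + (-r.1 : ℝ) * Complex.I)) - ∫ x in c..d, F (x + r.2 * Complex.I)))
      (atTop ×ˢ atTop) (𝓝 0) := by
    rw [← mul_zero ((2 * (Real.pi : ℂ) * Complex.I)⁻¹)]
    refine Tendsto.const_mul _ ?_
    have hbd : Tendsto (fun r : ℝ × ℝ => C * r.1 ^ (-(1 / 2) : ℝ) * |d - c|
        + C * r.2 ^ (-(1 / 2) : ℝ) * |d - c|) (atTop ×ˢ atTop) (𝓝 0) := by
      have h1 := ((tendsto_rpow_neg_half.comp (tendsto_fst (f := atTop) (g := (atTop : Filter ℝ)))).const_mul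
        C).mul_const |d - c|
      have h2 := ((tendsto_rpow_neg_half.comp (tendsto_snd (f := (atTop : Filter ℝ)) (g := atTop))).const_mul
        C).mul_const |d - c|
      simpa using h1.add h2
    refine squeeze_zero_norm' ?_ hbd
    filter_upwards [(eventually_ge_atTop (1 : ℝ)).prod_mk (eventually_ge_atTop (1 : ℝ))] with r hr
    refine (norm_sub_le _ _).trans (add_le_add ?_ ?_)
    · have := hside (-r.1) (by rw [abs_neg, abs_of_nonneg (by linarith [hr.1])]; exact hr.1)
      rwa [abs_neg, abs_of_nonneg (by linarith [hr.1])] at this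
    · have := hside r.2 (by rw [abs_of_nonneg (by linarith [hr.2])]; exact hr.2)
      rwa [abs_of_nonneg (by linarith [hr.2])] at this
  have := h.add hzero
  rw [add_zero] at this
  exact this.congr fun r => (hdiff r.1 r.2).symm

lemma hasVerticalIntegral_of_integrable {F : ℂ → ℂ} {c : ℝ}
    (h : Integrable fun t : ℝ => F (c + t * Complex.I)) :
    HasVerticalIntegral F c ((2 * Real.pi : ℂ)⁻¹ * ∫ t : ℝ, F (c + t * Complex.I)) := by
  have h1 := (intervalIntegral_tendsto_integral h
    (tendsto_neg_atTop_atBot.comp (tendsto_fst (f := atTop) (g := (atTop : Filter ℝ))))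
    (tendsto_snd (f := (atTop : Filter ℝ)) (g := atTop))).const_mul (2 * Real.pi : ℂ)⁻¹
  refine h1.congr fun r => ?_
  simp only [truncatedVerticalIntegral, intervalIntegral.integral_mul_const, Function.comp]
  have hcan : ∀ A : ℂ, (2 * (Real.pi : ℂ))⁻¹ * A = (2 * Real.pi * Complex.I)⁻¹ * (A * Complex.I) :=
    fun A => by
      have := Complex.I_ne_zero
      have hpi : (Real.pi : ℂ) ≠ 0 := by exact_mod_cast Real.pi_ne_zero
      field_simp
  exact hcan _

lemma HasVerticalIntegral.verticalIntegral_eq {F : ℂ → ℂ} {c : ℝ} {I : ℂ}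
    (h : HasVerticalIntegral F c I) : verticalIntegral F c = I := h.limUnder_eq

lemma integrable_of_norm_le_rpow {g : ℝ → ℂ} (hg : Continuous g) {C r : ℝ} (hC : 0 ≤ C) (hr : 1 < r)
    (h : ∀ t : ℝ, 1 ≤ |t| → ‖g t‖ ≤ C * |t| ^ (-r)) : Integrable g := by
  obtain ⟨M, hM⟩ := (isCompact_Icc (a := (-1 : ℝ)) (b := 1)).exists_bound_of_continuousOn
    hg.continuousOn
  have hM0 : 0 ≤ M := (norm_nonneg _).trans (hM 0 (by simp))
  have hint : Integrable (fun t : ℝ => (M + C) * 2 ^ r * (1 + ‖t‖) ^ (-r)) :=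
    (integrable_one_add_norm (by simpa using hr)).const_mul _
  refine hint.mono' hg.aestronglyMeasurable (Eventually.of_forall fun t => ?_)
  have hscale : ∀ x : ℝ, 0 < x → 1 + |t| ≤ 2 * x → x ^ (-r) ≤ 2 ^ r * (1 + |t|) ^ (-r) := by
    intro x hx hxt
    have h1 : (2 * x) ^ (-r) ≤ (1 + |t|) ^ (-r) :=
      Real.rpow_le_rpow_of_nonpos (by positivity) hxt (by linarith)
    rw [Real.mul_rpow (by norm_num) hx.le, Real.rpow_neg (by norm_num)] at h1
    rwa [inv_mul_le_iff₀ (by positivity)] at h1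
  rw [Real.norm_eq_abs, mul_assoc]
  rcases le_total 1 |t| with ht | ht
  · calc ‖g t‖ ≤ C * |t| ^ (-r) := h t ht
      _ ≤ (M + C) * (2 ^ r * (1 + |t|) ^ (-r)) := by
        have := hscale |t| (by linarith) (by linarith)
        have h3 : 0 ≤ 2 ^ r * (1 + |t|) ^ (-r) := by positivity
        gcongr
        linarith
  · have h1 := hscale 1 one_pos (by linarith)
    rw [Real.one_rpow] at h1
    calc ‖g t‖ ≤ M := hM t (abs_le.mp ht)
      _ ≤ (M + C) * 1 := by linarith
      _ ≤ _ := by gcongr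

section Primitives

variable {p q : ℕ} {D : ℝ}

/-- The value of the contour integral of `mellinIntegrand`, taken over the line `Re s = 3/4` of
absolute convergence. -/
def mellinIntegral (p q : ℕ) (D : ℝ) (m : ℕ) (w : ℝ) : ℂ :=
  (2 * Real.pi : ℂ)⁻¹ * ∫ t : ℝ, mellinIntegrand p q D m w ((3 / 4 : ℝ) + t * Complex.I)

lemma continuous_phiQuotient_div (hD : 0 < D) (m : ℕ) :
    Continuous fun t : ℝ => phiQuotient p q D ((3 / 4 : ℝ) + t * Complex.I) /
      ∏ j ∈ Finset.range m, (((3 / 4 : ℝ) + t * Complex.I) + (j + 1 : ℕ)) := by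
  refine Continuous.div ?_ (by fun_prop) fun t => prod_add_natCast_succ_ne_zero m (by simp; norm_num)
  refine continuous_iff_continuousAt.mpr fun t => ?_
  have h1 := (differentiableAt_phiQuotient (p := p) (q := q) hD
    (s := (3 / 4 : ℝ) + t * Complex.I) (by simp; norm_num)).continuousAt
  exact ContinuousAt.comp (f := fun t : ℝ => ((3 / 4 : ℝ) : ℂ) + t * Complex.I) h1 (by fun_prop)

/-- At σ = 3/4 the exponent is -n/4 - 1 - m, which is at most -3/2 because n ≥ 2. -/
lemma integrable_phiQuotient_div (hD : 0 < D) (hp : p ≠ 0) (hn : 2 ≤ p + q) (m : ℕ) :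
    Integrable fun t : ℝ => phiQuotient p q D ((3 / 4 : ℝ) + t * Complex.I) /
      ∏ j ∈ Finset.range m, (((3 / 4 : ℝ) + t * Complex.I) + (j + 1 : ℕ)) := by
  obtain ⟨C, hC, h⟩ := norm_phiQuotient_div_le (q := q) hD hp
  refine integrable_of_norm_le_rpow (continuous_phiQuotient_div hD m) hC.le
    (r := 3 / 2) (by norm_num) fun t ht => ?_
  refine (h m (3 / 4) t (by norm_num) le_rfl ht).trans ?_
  gcongr
  · have h2 : (2 : ℝ) ≤ (p + q : ℕ) := by exact_mod_cast hn
    have h3 : (0 : ℝ) ≤ m := by positivity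
    linarith

lemma continuous_mellinIntegrand_line (hD : 0 < D) (m : ℕ) {w : ℝ} (hw : 0 < w) :
    Continuous fun t : ℝ => mellinIntegrand p q D m w ((3 / 4 : ℝ) + t * Complex.I) := by
  have hwc : (w : ℂ) ≠ 0 := by exact_mod_cast hw.ne'
  refine Continuous.mul ?_ (continuous_phiQuotient_div hD m)
  exact Continuous.const_cpow (by fun_prop) (Or.inl hwc)

lemma norm_mellinIntegrand_le {w v : ℝ} (hw : 0 < w) (hwv : w ≤ v) (m : ℕ) (t : ℝ) :
    ‖mellinIntegrand p q D m w ((3 / 4 : ℝ) + t * Complex.I)‖ ≤ v ^ ((3 / 4 : ℝ) + m) *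
      ‖phiQuotient p q D ((3 / 4 : ℝ) + t * Complex.I) /
        ∏ j ∈ Finset.range m, (((3 / 4 : ℝ) + t * Complex.I) + (j + 1 : ℕ))‖ := by
  rw [norm_mellinIntegrand m hw]
  have : (((3 / 4 : ℝ) : ℂ) + t * Complex.I).re = 3 / 4 := by simp
  rw [this]
  gcongr

lemma integrable_mellinIntegrand_line (hD : 0 < D) (hp : p ≠ 0) (hn : 2 ≤ p + q) (m : ℕ) {w : ℝ}
    (hw : 0 < w) :
    Integrable fun t : ℝ => mellinIntegrand p q D m w ((3 / 4 : ℝ) + t * Complex.I) :=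
  ((integrable_phiQuotient_div hD hp hn m).norm.const_mul (w ^ ((3 / 4 : ℝ) + m))).mono'
    (continuous_mellinIntegrand_line hD m hw).aestronglyMeasurable
    (Eventually.of_forall fun t => norm_mellinIntegrand_le hw le_rfl m t)

lemma hasDerivAt_mellinIntegrand (m : ℕ) {w : ℝ} (hw : 0 < w) {s : ℂ} (hs : -1 < s.re) :
    HasDerivAt (fun w : ℝ => mellinIntegrand p q D (m + 1) w s) (mellinIntegrand p q D m w s) w := by
  have h0 : s + m + 1 ≠ 0 := fun h => by
    have := congrArg Complex.re h
    simp at this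
    have h2 : (0 : ℝ) ≤ m := by positivity
    linarith
  have h1 := (hasDerivAt_ofReal_cpow_const' hw.ne' (r := s + m)
    (fun h => h0 (by rw [h, neg_add_cancel]))).mul_const
    (phiQuotient p q D s / ∏ j ∈ Finset.range m, (s + (j + 1 : ℕ)))
  refine h1.congr_of_eventuallyEq (Eventually.of_forall fun v => ?_)
  simp only [mellinIntegrand]
  rw [Finset.prod_range_succ]
  have h2 := prod_add_natCast_succ_ne_zero m hs
  have h3 : s + (m + 1 : ℕ) = s + m + 1 := by push_cast; ring
  rw [h3]
  field_simp

/-- Differentiating w^(s+m+1) cancels the last factor s + m + 1 of the denominator. Absolute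
convergence on Re s = 3/4 provides the dominating function, taken at 2w. -/
lemma hasDerivAt_mellinIntegral (hD : 0 < D) (hp : p ≠ 0) (hn : 2 ≤ p + q) (m : ℕ) {w : ℝ}
    (hw : 0 < w) :
    HasDerivAt (mellinIntegral p q D (m + 1)) (mellinIntegral p q D m w) w := by
  have hball : Set.Ioo 0 (2 * w) ∈ 𝓝 w := Ioo_mem_nhds hw (by linarith)
  refine HasDerivAt.const_mul _ (hasDerivAt_integral_of_dominated_loc_of_deriv_le
    (F := fun (w : ℝ) (t : ℝ) => mellinIntegrand p q D (m + 1) w ((3 / 4 : ℝ) + t * Complex.I))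
    (F' := fun (w : ℝ) (t : ℝ) => mellinIntegrand p q D m w ((3 / 4 : ℝ) + t * Complex.I))
    hball ?_ (integrable_mellinIntegrand_line hD hp hn (m + 1) hw)
    (continuous_mellinIntegrand_line hD m hw).aestronglyMeasurable
    (Eventually.of_forall fun t v hv => norm_mellinIntegrand_le hv.1 hv.2.le m t)
    ((integrable_phiQuotient_div hD hp hn m).norm.const_mul _)
    (Eventually.of_forall fun t v hv => hasDerivAt_mellinIntegrand m hv.1 ?_)).2
  · filter_upwards [hball] with v hv
    exact (continuous_mellinIntegrand_line hD (m + 1) hv.1).aestronglyMeasurable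
  · simp
    norm_num

lemma continuousOn_mellinIntegral (hD : 0 < D) (hp : p ≠ 0) (hn : 2 ≤ p + q) (m : ℕ) :
    ContinuousOn (mellinIntegral p q D m) (Set.Ioi 0) := by
  intro w hw
  have hw : 0 < w := hw
  have hball : Set.Ioo 0 (2 * w) ∈ 𝓝 w := Ioo_mem_nhds hw (by linarith)
  refine ContinuousAt.continuousWithinAt (ContinuousAt.mul continuousAt_const
    (continuousAt_of_dominated (bound := fun t => (2 * w) ^ ((3 / 4 : ℝ) + m) *
      ‖phiQuotient p q D ((3 / 4 : ℝ) + t * Complex.I) /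
        ∏ j ∈ Finset.range m, (((3 / 4 : ℝ) + t * Complex.I) + (j + 1 : ℕ))‖) ?_ ?_
      ((integrable_phiQuotient_div hD hp hn m).norm.const_mul _)
      (Eventually.of_forall fun t => ?_)))
  · filter_upwards [hball] with v hv
    exact (continuous_mellinIntegrand_line hD m hv.1).aestronglyMeasurable
  · filter_upwards [hball] with v hv
    exact Eventually.of_forall fun t => norm_mellinIntegrand_le hv.1 hv.2.le m t
  · simp only [mellinIntegrand]
    refine ContinuousAt.mul ?_ continuousAt_const
    exact Complex.continuousAt_ofReal_cpow_const _ _ (Or.inr hw.ne')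

/-- The hypothesis `hcm` says that the exponent of |t| on the line c is at most -1/2; it only
decreases to the right, so the horizontal sides up to Re s = 3/4 vanish in the limit. -/
lemma hasVerticalIntegral_mellinIntegrand (hD : 0 < D) (hp : p ≠ 0) (hn : 2 ≤ p + q) (m : ℕ)
    {w : ℝ} (hw : 0 < w) {c : ℝ} (hc : -(3 / 4) ≤ c) (hc' : c ≤ 3 / 4)
    (hcm : (p + q : ℕ) * (1 / 2 - c) ≤ m + 1 / 2) :
    HasVerticalIntegral (mellinIntegrand p q D m w) c (mellinIntegral p q D m w) := by
  obtain ⟨C, hC, h⟩ := norm_phiQuotient_div_le (q := q) hD hp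
  refine HasVerticalIntegral.shift_left (C := Real.exp (((3 / 4 : ℝ) + m) * |Real.log w|) * C) hc'
    (fun s hs hs' => differentiableAt_mellinIntegrand hD m hw (by linarith) (by linarith)) ?_
    (hasVerticalIntegral_of_integrable (integrable_mellinIntegrand_line hD hp hn m hw))
  intro x t hx hx' ht
  rw [norm_mellinIntegrand m hw, mul_assoc]
  have hre : ((x : ℂ) + t * Complex.I).re = x := by simp
  rw [hre]
  have hm : (0 : ℝ) ≤ m := by positivity
  gcongr
  · rw [Real.rpow_def_of_pos hw]
    apply Real.exp_le_exp.mpr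
    have h2 : |x + m| ≤ 3 / 4 + m := by rw [abs_le]; constructor <;> linarith
    calc Real.log w * (x + m) ≤ |Real.log w * (x + m)| := le_abs_self _
      _ = |x + m| * |Real.log w| := by rw [abs_mul, mul_comm]
      _ ≤ _ := by gcongr
  · refine (h m x t (by linarith) hx' ht).trans ?_
    gcongr
    · have h2 : ((p + q : ℕ) : ℝ) * (1 / 2 - x) ≤ (p + q : ℕ) * (1 / 2 - c) := by gcongr
      linarith

end Primitives

section IteratedPrimitives

variable {J : ℕ → ℝ → ℂ}

lemma contDiffOn_of_hasDerivAt_succ (h0 : ContinuousOn (J 0) (Set.Ioi 0))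
    (h : ∀ m : ℕ, ∀ w : ℝ, 0 < w → HasDerivAt (J (m + 1)) (J m w) w) (m : ℕ) :
    ContDiffOn ℝ m (J m) (Set.Ioi 0) := by
  induction m with
  | zero => simpa [contDiffOn_zero] using h0
  | succ m ih =>
    rw [Nat.cast_succ, contDiffOn_succ_iff_deriv_of_isOpen isOpen_Ioi]
    refine ⟨fun w hw => (h m w hw).differentiableAt.differentiableWithinAt, by simp, ?_⟩
    exact ih.congr fun w hw => (h m w hw).deriv

lemma iteratedDeriv_eq_of_hasDerivAt_succ
    (h : ∀ m : ℕ, ∀ w : ℝ, 0 < w → HasDerivAt (J (m + 1)) (J m w) w) {f : ℝ → ℂ} (k : ℕ) :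
    ∀ m : ℕ, (∀ w : ℝ, 0 < w → f w = J (m + k) w) →
      ∀ w : ℝ, 0 < w → iteratedDeriv k f w = J m w := by
  induction k with
  | zero => simp
  | succ k ih =>
    intro m hf w hw
    rw [iteratedDeriv_succ]
    have h1 : iteratedDeriv k f =ᶠ[𝓝 w] J (m + 1) := by
      filter_upwards [Ioi_mem_nhds hw] with v hv
      refine ih (m + 1) (fun u hu => ?_) v hv
      rw [hf u hu, add_right_comm, add_assoc]
    rw [h1.deriv_eq, (h m w hw).deriv]

end IteratedPrimitives

end MellinIntegrals

/-! ### Uniform bounds on the extreme lines -/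

section Bounds

open ComplexConjugate MeasureTheory

/-- The partial products stay in the unit disc, so the deviations from 1 add up without compounding.
-/
lemma norm_prod_range_le_one_and_sub_one_le {a : ℕ → ℂ} {e : ℝ} (k : ℕ)
    (h1 : ∀ j < k, ‖a j‖ ≤ 1) (he : ∀ j < k, ‖a j - 1‖ ≤ e) :
    ‖∏ j ∈ Finset.range k, a j‖ ≤ 1 ∧ ‖∏ j ∈ Finset.range k, a j - 1‖ ≤ k * e := by
  induction k with
  | zero => simp
  | succ k ih =>
    obtain ⟨ih1, ih2⟩ := ih (fun j hj => h1 j (by omega)) (fun j hj => he j (by omega))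
    rw [Finset.prod_range_succ]
    refine ⟨?_, ?_⟩
    · rw [norm_mul]
      exact mul_le_one₀ ih1 (norm_nonneg _) (h1 k (by omega))
    · have e1 : (∏ j ∈ Finset.range k, a j) * a k - 1
          = (∏ j ∈ Finset.range k, a j) * (a k - 1) + (∏ j ∈ Finset.range k, a j - 1) := by ring
      rw [e1]
      refine (norm_add_le _ _).trans ?_
      rw [norm_mul]
      have := mul_le_mul ih1 (he k (by omega)) (norm_nonneg _) zero_le_one
      push_cast
      linarith

lemma exp_div_sub_one_le {c τ : ℝ} (hτ : 1 ≤ τ) :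
    Real.exp (c / τ) - 1 ≤ (Real.exp c - 1) / τ := by
  have hτ0 : 0 < τ := by linarith
  have ha : 0 ≤ 1 / τ := by positivity
  have hb : 0 ≤ 1 - 1 / τ := by rw [sub_nonneg, div_le_one hτ0]; exact hτ
  have h := convexOn_exp.2 (Set.mem_univ c) (Set.mem_univ (0 : ℝ)) ha hb (by ring)
  simp only [smul_eq_mul, mul_zero, add_zero, Real.exp_zero, mul_one] at h
  have e1 : 1 / τ * c = c / τ := by ring
  have e2 : (Real.exp c - 1) / τ = 1 / τ * Real.exp c - 1 / τ := by ring
  rw [e1] at h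
  rw [e2]
  linarith

section Bound

variable {p q : ℕ} {D : ℝ}

lemma ofReal_add_mul_I_ne_zero_of_one_le (σ : ℝ) {τ : ℝ} (hτ : 1 ≤ τ) :
    (σ : ℂ) + (-τ : ℝ) * Complex.I ≠ 0 := fun h => by
  have := congrArg Complex.im h
  simp at this
  linarith

/-- On the lower half of a vertical line, the integrand is an explicit oscillating function
up to an absolutely integrable error. -/
lemma exists_norm_mellinIntegrand_sub_le (hD : 0 < D) (hp : p ≠ 0) {w σ : ℝ} (hw : 0 < w) {m : ℕ}
    (hσ : -(3 / 4) ≤ σ) (hσ' : σ ≤ 1 / 2) (hσm : (p + q : ℕ) * (1 / 2 - σ) = m + 1 / 2) :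
    ∃ (c : ℂ) (L : ℝ), ‖c‖ = 1 ∧ ∀ τ : ℝ, 1 ≤ τ →
      ‖mellinIntegrand p q D m w (σ + (-τ : ℝ) * Complex.I) -
        c * (((τ ^ (-(1 / 2) : ℝ) : ℝ) : ℂ) * Complex.exp (Complex.I *
          (((p + q : ℕ) * (τ * (Real.log τ - L) - τ) : ℝ) : ℂ))) *
        ((w ^ (σ + m) * (D ^ (1 / 2 - σ) * (2 * Real.pi) ^ (-((m : ℝ) + 1 / 2))) : ℝ) : ℂ)‖
      ≤ w ^ (σ + m) * (D ^ (1 / 2 - σ) * (2 * Real.pi) ^ (-((m : ℝ) + 1 / 2))) *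
        ((Real.exp (4.4 * (p + q : ℕ)) + (m + 1) ^ 2) * τ ^ (-(3 / 2) : ℝ)) := by
  have hn : p + q ≠ 0 := by omega
  have hnr : ((p + q : ℕ) : ℝ) ≠ 0 := by exact_mod_cast hn
  obtain ⟨c, hc, h⟩ := exists_phi_eq p q hD hn
  -- The oscillation -τ log w of w^s is absorbed into L, and the power of i comes from ∏ (s + j) ≈
  -- (-iτ)^(m+1). On the lower half of the line, 1 - s lies in the upper half-plane, where the
  -- asymptotics of `phi` were proved.
  refine ⟨c * Complex.I ^ (m + 1), Real.log (2 * Real.pi) - Real.log D / (p + q : ℕ)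
    + Real.log w / (p + q : ℕ), by simp [hc], fun τ hτ => ?_⟩
  have hτ0 : 0 < τ := by linarith
  have hτc : (τ : ℂ) ≠ 0 := by exact_mod_cast hτ0.ne'
  have hwc : (w : ℂ) ≠ 0 := by exact_mod_cast hw.ne'
  obtain ⟨X, hX, hphi⟩ := h (1 - σ) τ (by linarith) (by linarith) hτ
  set s : ℂ := σ + (-τ : ℝ) * Complex.I with hs
  have hsj : ∀ j : ℕ, τ ≤ ‖s + j‖ := fun j => by
    refine le_trans ?_ (Complex.abs_im_le_norm _)
    simp [hs, abs_of_pos hτ0]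
  have hsj0 : ∀ j : ℕ, s + j ≠ 0 := fun j => norm_pos_iff.mp (hτ0.trans_le (hsj j))
  set Y : ℂ := ∏ j ∈ Finset.range (m + 1), ((-τ : ℝ) * Complex.I) / (s + j) with hY
  obtain ⟨hY1, hY2⟩ := norm_prod_range_le_one_and_sub_one_le
    (a := fun j : ℕ => ((-τ : ℝ) * Complex.I) / (s + j)) (e := (m + 1) / τ) (m + 1)
    (fun j _ => by
      rw [norm_div, norm_mul, Complex.norm_I, mul_one, Complex.norm_real, norm_neg,
        Real.norm_of_nonneg hτ0.le]
      exact div_le_one_of_le₀ (hsj j) (norm_nonneg _))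
    (fun j hj => by
      have e1 : ((-τ : ℝ) * Complex.I) / (s + j) - 1 = -((σ + j : ℝ) : ℂ) / (s + j) := by
        have := hsj0 j
        field_simp
        simp only [hs]
        push_cast
        ring
      have hjm : (j : ℝ) ≤ m := by exact_mod_cast Nat.lt_succ_iff.mp hj
      have hj0 : (0 : ℝ) ≤ j := by positivity
      rw [e1, norm_div, norm_neg, Complex.norm_real]
      have : ‖σ + j‖ ≤ m + 1 := by
        rw [Real.norm_eq_abs, abs_le]; constructor <;> linarith
      have := hsj j
      gcongr)
  rw [← hY] at hY1 hY2
  -- X carries the Stirling error and Y the error of replacing every s + j by -iτ; both are O(1/τ),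
  -- which turns τ^(-1/2) into the integrable τ^(-3/2).
  have hXY : ‖X * Y - 1‖ ≤ (Real.exp (4.4 * (p + q : ℕ)) + (m + 1) ^ 2) / τ := by
    have e1 : X * Y - 1 = (X - 1) * Y + (Y - 1) := by ring
    rw [e1]
    refine (norm_add_le _ _).trans ?_
    rw [norm_mul]
    have h1 : ‖X - 1‖ ≤ (Real.exp (4.4 * (p + q : ℕ)) - 1) / τ :=
      le_trans hX (exp_div_sub_one_le hτ)
    have h2 := mul_le_mul h1 hY1 (norm_nonneg _) ((norm_nonneg _).trans h1)
    have h3 : (Real.exp (4.4 * (p + q : ℕ)) + ((m : ℝ) + 1) ^ 2) / τ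
      = (Real.exp (4.4 * (p + q : ℕ)) - 1) / τ * 1 + ((m + 1 : ℕ) : ℝ) * ((m + 1) / τ) + 1 / τ := by
      push_cast; ring
    have h4 : 0 ≤ 1 / τ := by positivity
    rw [h3]
    linarith
  have hs1 : 1 - s = ((1 - σ : ℝ) : ℂ) + τ * Complex.I := by
    simp only [hs]; push_cast; ring
  have hprodY : (∏ j ∈ Finset.range (m + 1), (s + j))⁻¹
      = Y * (Complex.I ^ (m + 1) * ((τ ^ (-((m : ℝ) + 1)) : ℝ) : ℂ)) := by
    rw [hY, Finset.prod_div_distrib, Finset.prod_const, Finset.card_range, div_eq_mul_inv]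
    have e1 : (((-τ : ℝ) : ℂ) * Complex.I) ^ (m + 1) * (Complex.I ^ (m + 1)
        * ((τ ^ (-((m : ℝ) + 1)) : ℝ) : ℂ)) = 1 := by
      rw [← mul_assoc, ← mul_pow]
      have e2 : ((-τ : ℝ) : ℂ) * Complex.I * Complex.I = (τ : ℂ) := by
        push_cast
        linear_combination (-(τ : ℂ)) * Complex.I_mul_I
      have e3 : τ ^ (-((m : ℝ) + 1)) = (τ ^ (m + 1))⁻¹ := by
        rw [Real.rpow_neg hτ0.le, ← Nat.cast_succ, Real.rpow_natCast]
      rw [e2, e3]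
      push_cast
      exact mul_inv_cancel₀ (pow_ne_zero _ hτc)
    rw [mul_right_comm, e1, one_mul]
  have hwpow : (w : ℂ) ^ (s + m) = ((w ^ (σ + m) : ℝ) : ℂ)
      * Complex.exp (Complex.I * ((-(τ * Real.log w) : ℝ) : ℂ)) := by
    rw [Complex.cpow_def_of_ne_zero hwc, ← Complex.ofReal_log hw.le, Real.rpow_def_of_pos hw,
      Complex.ofReal_exp, ← Complex.exp_add]
    congr 1
    simp only [hs]
    push_cast
    ring
  have hb : (2 * Real.pi) ^ ((p + q : ℕ) * (1 / 2 - (1 - σ)))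
      = (2 * Real.pi) ^ (-((m : ℝ) + 1 / 2)) := by
    congr 1
    linarith
  have hd : D ^ (1 - σ - 1 / 2) = D ^ (1 / 2 - σ) := by congr 1; ring
  have ht : τ ^ ((p + q : ℕ) * (1 - σ - 1 / 2)) * τ ^ (-((m : ℝ) + 1)) = τ ^ (-(1 / 2) : ℝ) := by
    rw [← Real.rpow_add hτ0]
    congr 1
    linarith
  have hexp : Complex.exp (Complex.I * (((p + q : ℕ) * (τ * (Real.log τ -
          (Real.log (2 * Real.pi) - Real.log D / (p + q : ℕ))) - τ) : ℝ) : ℂ))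
        * Complex.exp (Complex.I * ((-(τ * Real.log w) : ℝ) : ℂ))
      = Complex.exp (Complex.I * (((p + q : ℕ) * (τ * (Real.log τ -
          (Real.log (2 * Real.pi) - Real.log D / (p + q : ℕ) + Real.log w / (p + q : ℕ))) - τ) : ℝ)
          : ℂ)) := by
    rw [← Complex.exp_add, ← mul_add, ← Complex.ofReal_add]
    congr 3
    field_simp
    ring
  have hF : mellinIntegrand p q D m w s = c * Complex.I ^ (m + 1) *
      (((τ ^ (-(1 / 2) : ℝ) : ℝ) : ℂ) * Complex.exp (Complex.I * (((p + q : ℕ) * (τ * (Real.log τ -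
        (Real.log (2 * Real.pi) - Real.log D / (p + q : ℕ) + Real.log w / (p + q : ℕ))) - τ) : ℝ)
        : ℂ))) * ((w ^ (σ + m) * (D ^ (1 / 2 - σ) * (2 * Real.pi) ^ (-((m : ℝ) + 1 / 2))) : ℝ) : ℂ)
        * (X * Y) := by
    rw [mellinIntegrand_of_ne_zero hp m w (ofReal_add_mul_I_ne_zero_of_one_le σ hτ), ← hs, hs1, hphi,
      div_eq_mul_inv, hprodY, hwpow, hb, hd, ← hexp, ← ht]
    push_cast
    ring
  rw [hF]
  have hfac : ∀ M B Z : ℂ, M * B * Z - M * B = M * B * (Z - 1) := fun M B Z => by ring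
  rw [hfac, norm_mul, norm_mul, norm_mul, norm_mul, norm_mul, hc, norm_pow, Complex.norm_I, one_pow,
    Complex.norm_real, Complex.norm_real, Real.norm_of_nonneg (by positivity),
    Real.norm_of_nonneg (by positivity), mul_comm Complex.I, Complex.norm_exp_ofReal_mul_I]
  have h32 : τ ^ (-(3 / 2) : ℝ) = τ ^ (-(1 / 2) : ℝ) / τ := by
    rw [← Real.rpow_sub_one hτ0.ne']
    norm_num
  rw [h32]
  calc _ ≤ 1 * 1 * (τ ^ (-(1 / 2) : ℝ) * 1) *
        (w ^ (σ + m) * (D ^ (1 / 2 - σ) * (2 * Real.pi) ^ (-((m : ℝ) + 1 / 2))))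
        * ((Real.exp (4.4 * (p + q : ℕ)) + (m + 1) ^ 2) / τ) := by gcongr
    _ = _ := by ring

lemma continuous_mellinIntegrand_lower (hD : 0 < D) {w σ : ℝ} (hw : 0 < w) (m : ℕ) (hσ : -1 < σ)
    (hσ' : σ < 1) :
    Continuous fun t : ℝ => mellinIntegrand p q D m w (σ + (-t : ℝ) * Complex.I) := by
  refine continuous_iff_continuousAt.mpr fun t => ?_
  have h1 := (differentiableAt_mellinIntegrand (p := p) (q := q) hD m hw
    (s := σ + (-t : ℝ) * Complex.I) (by simpa using hσ) (by simpa using hσ')).continuousAt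
  exact ContinuousAt.comp (f := fun t : ℝ => (σ : ℂ) + (-t : ℝ) * Complex.I) h1 (by fun_prop)

lemma integral_rpow_neg_three_halves_le {b : ℝ} (hb : 1 ≤ b) :
    ∫ t in (1 : ℝ)..b, t ^ (-(3 / 2) : ℝ) ≤ 2 := by
  have h0 : (0 : ℝ) ∉ Set.uIcc 1 b := by
    rw [Set.uIcc_of_le hb]
    exact fun h => by linarith [h.1]
  rw [integral_rpow (Or.inr ⟨by norm_num, h0⟩)]
  have h1 : 0 ≤ b ^ (-(1 / 2) : ℝ) := by positivity
  norm_num at h1 ⊢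
  linarith

/-- Three contributions: [0, 1] by the trivial bound, with `hprod` keeping the denominator away from
0; the oscillating part beyond 1, at most 13; and the error, with ∫ t^(-3/2) dt ≤ 2. -/
lemma norm_integral_mellinIntegrand_lower_le (hD : 0 < D) (hp : p ≠ 0) (hn : 2 ≤ p + q) {w σ : ℝ}
    (hw : 0 < w) {m : ℕ} (hσ : -(3 / 4) ≤ σ) (hσ' : σ ≤ 1 / 2) (hσ0 : σ ≠ 0)
    (hσm : (p + q : ℕ) * (1 / 2 - σ) = m + 1 / 2)
    (hprod : ∀ t : ℝ, 1 ≤ 8 * ‖∏ j ∈ Finset.range (m + 1), ((σ + (-t : ℝ) * Complex.I) + (j : ℂ))‖)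
    {b : ℝ} (hb : 1 ≤ b) :
    ‖∫ t in (0 : ℝ)..b, mellinIntegrand p q D m w (σ + (-t : ℝ) * Complex.I)‖
      ≤ w ^ (σ + m) * D ^ (1 / 2 - σ) * (8 * 10 ^ (p + q) + (2 * Real.pi) ^ (-((m : ℝ) + 1 / 2)) *
        (13 + 2 * (Real.exp (4.4 * (p + q : ℕ)) + (m + 1) ^ 2))) := by
  have hcont := continuous_mellinIntegrand_lower (p := p) (q := q) hD hw m (by linarith : -1 < σ)
    (by linarith)
  set F : ℝ → ℂ := fun t => mellinIntegrand p q D m w (σ + (-t : ℝ) * Complex.I) with hF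
  have h01 : ‖∫ t in (0 : ℝ)..1, F t‖ ≤ w ^ (σ + m) * D ^ (1 / 2 - σ) * (8 * 10 ^ (p + q)) := by
    have hbd : ∀ t ∈ Set.uIoc (0 : ℝ) 1,
        ‖F t‖ ≤ w ^ (σ + m) * D ^ (1 / 2 - σ) * (8 * 10 ^ (p + q)) := by
      intro t ht
      rw [Set.uIoc_of_le zero_le_one] at ht
      have hs0 : (σ : ℂ) + (-t : ℝ) * Complex.I ≠ 0 := fun h => hσ0 (by
        simpa using congrArg Complex.re h)
      have hphi := norm_phi_le_of_abs_le_one p q hD (β := 1 - σ) (τ := t) (by linarith)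
        (by linarith) (by rw [abs_of_pos ht.1]; exact ht.2)
      have e1 : 1 - ((σ : ℂ) + (-t : ℝ) * Complex.I) = ((1 - σ : ℝ) : ℂ) + t * Complex.I := by
        push_cast; ring
      have e2 : 1 - σ - 1 / 2 = 1 / 2 - σ := by ring
      rw [e2] at hphi
      simp only [hF]
      rw [mellinIntegrand_of_ne_zero hp m w hs0, e1, norm_mul, norm_div,
        Complex.norm_cpow_eq_rpow_re_of_pos hw]
      have e3 : ((σ : ℂ) + (-t : ℝ) * Complex.I + m).re = σ + m := by simp
      rw [e3]
      have hP := hprod t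
      have e4 : w ^ (σ + m) / ‖∏ j ∈ Finset.range (m + 1), ((σ + (-t : ℝ) * Complex.I) + (j : ℂ))‖
          ≤ w ^ (σ + m) * 8 := by
        rw [div_le_iff₀ (by linarith), mul_assoc]
        exact le_mul_of_one_le_right (by positivity) hP
      calc _ ≤ w ^ (σ + m) * 8 * (D ^ (1 / 2 - σ) * 10 ^ (p + q)) := by gcongr
        _ = _ := by ring
    have := intervalIntegral.norm_integral_le_of_norm_le_const hbd
    simpa using this
  obtain ⟨c, L, hc, hdiff⟩ := exists_norm_mellinIntegrand_sub_le (q := q) hD hp hw hσ hσ' hσm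
  set A : ℝ := w ^ (σ + m) * (D ^ (1 / 2 - σ) * (2 * Real.pi) ^ (-((m : ℝ) + 1 / 2))) with hA
  have hA0 : 0 ≤ A := by positivity
  set E : ℝ := Real.exp (4.4 * (p + q : ℕ)) + (m + 1) ^ 2 with hE
  have hE0 : 0 ≤ E := by positivity
  set G : ℝ → ℂ := fun t => ((t ^ (-(1 / 2) : ℝ) : ℝ) : ℂ) * Complex.exp (Complex.I *
          (((p + q : ℕ) * (t * (Real.log t - L) - t) : ℝ) : ℂ)) with hG
  have hGint : IntervalIntegrable G volume 1 b := by
    refine ContinuousOn.intervalIntegrable fun t ht => ?_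
    rw [Set.uIcc_of_le hb] at ht
    have ht0 : t ≠ 0 := by linarith [ht.1]
    have h1 := Real.continuousAt_log ht0
    have h2 : ContinuousAt (fun t : ℝ => t ^ (-(1 / 2) : ℝ)) t :=
      Real.continuousAt_rpow_const _ _ (Or.inl ht0)
    refine ContinuousAt.continuousWithinAt ?_
    simp only [hG]
    fun_prop
  have hGle : ‖∫ t in (1 : ℝ)..b, G t‖ ≤ 13 :=
    norm_integral_rpow_exp_phase_le (by exact_mod_cast hn) hb
  have hcGint : IntervalIntegrable (fun t => c * G t * (A : ℂ)) volume 1 b :=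
    (hGint.const_mul c).mul_const _
  have h32 : IntervalIntegrable (fun t : ℝ => t ^ (-(3 / 2) : ℝ)) volume 1 b := by
    refine intervalIntegral.intervalIntegrable_rpow (Or.inr fun h => ?_)
    rw [Set.uIcc_of_le hb] at h
    linarith [h.1]
  have herr : ‖∫ t in (1 : ℝ)..b, (F t - c * G t * (A : ℂ))‖ ≤ A * (E * 2) := by
    have h2 : ‖∫ t in (1 : ℝ)..b, (F t - c * G t * (A : ℂ))‖
        ≤ ∫ t in (1 : ℝ)..b, A * (E * t ^ (-(3 / 2) : ℝ)) :=
      intervalIntegral.norm_integral_le_of_norm_le hb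
        (ae_of_all _ fun t ht => hdiff t ht.1.le) ((h32.const_mul E).const_mul A)
    refine h2.trans ?_
    rw [intervalIntegral.integral_const_mul, intervalIntegral.integral_const_mul]
    have := integral_rpow_neg_three_halves_le hb
    gcongr
  have h1b : ‖∫ t in (1 : ℝ)..b, F t‖ ≤ A * (13 + 2 * E) := by
    have e1 : ∫ t in (1 : ℝ)..b, F t = (∫ t in (1 : ℝ)..b, (F t - c * G t * (A : ℂ)))
        + c * (∫ t in (1 : ℝ)..b, G t) * A := by
      rw [intervalIntegral.integral_sub (hcont.intervalIntegrable _ _) hcGint,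
        intervalIntegral.integral_mul_const, intervalIntegral.integral_const_mul]
      ring
    rw [e1]
    refine (norm_add_le _ _).trans ?_
    rw [norm_mul, norm_mul, hc, one_mul, Complex.norm_real, Real.norm_of_nonneg hA0]
    have := mul_le_mul_of_nonneg_right hGle hA0
    linarith
  rw [← intervalIntegral.integral_add_adjacent_intervals (hcont.intervalIntegrable 0 1)
    (hcont.intervalIntegrable 1 b)]
  refine (norm_add_le _ _).trans ((add_le_add h01 h1b).trans (le_of_eq ?_))
  rw [hA]
  ring

lemma mellinIntegrand_conj (hD : 0 < D) (hp : p ≠ 0) (m : ℕ) {w : ℝ} (hw : 0 < w) {s : ℂ}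
    (hs : s ≠ 0) :
    mellinIntegrand p q D m w (conj s) = conj (mellinIntegrand p q D m w s) := by
  have hs' : conj s ≠ 0 := by simpa using hs
  rw [mellinIntegrand_of_ne_zero hp m w hs, mellinIntegrand_of_ne_zero hp m w hs']
  simp only [map_mul, map_div₀, map_prod, map_add, Complex.conj_natCast, ← ofReal_cpow_conj hw,
    ← phi_conj p q hD, map_sub, map_one]

/-- Conjugation reduces the upper half of the line to the lower one. The bound on truncated
integrals does not depend on the truncation, so it survives the limit; the two halves and the factor
1/(2π) give 1/π. -/
lemma norm_mellinIntegral_le (hD : 0 < D) (hp : p ≠ 0) (hn : 2 ≤ p + q) {w σ : ℝ}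
    (hw : 0 < w) {m : ℕ} (hσ : -(3 / 4) ≤ σ) (hσ' : σ ≤ 1 / 2) (hσ0 : σ ≠ 0)
    (hσm : (p + q : ℕ) * (1 / 2 - σ) = m + 1 / 2)
    (hprod : ∀ t : ℝ, 1 ≤ 8 * ‖∏ j ∈ Finset.range (m + 1), ((σ + (-t : ℝ) * Complex.I) + (j : ℂ))‖) :
    ‖mellinIntegral p q D m w‖
      ≤ w ^ (σ + m) * D ^ (1 / 2 - σ) * (Real.pi⁻¹ * (8 * 10 ^ (p + q) +
        (2 * Real.pi) ^ (-((m : ℝ) + 1 / 2)) *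
          (13 + 2 * (Real.exp (4.4 * (p + q : ℕ)) + (m + 1) ^ 2)))) := by
  have hlim := hasVerticalIntegral_mellinIntegrand hD hp hn m hw hσ (by linarith : σ ≤ 3 / 4) hσm.le
  refine le_of_tendsto hlim.norm ?_
  filter_upwards [(eventually_ge_atTop (1 : ℝ)).prod_mk (eventually_ge_atTop (1 : ℝ))] with r hr
  have hlow := fun b hb => norm_integral_mellinIntegrand_lower_le (q := q) hD hp hn hw hσ hσ' hσ0
    hσm hprod (b := b) hb
  set T := w ^ (σ + m) * D ^ (1 / 2 - σ) * (8 * 10 ^ (p + q) +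
    (2 * Real.pi) ^ (-((m : ℝ) + 1 / 2)) *
      (13 + 2 * (Real.exp (4.4 * (p + q : ℕ)) + (m + 1) ^ 2))) with hT
  have hcont := continuous_mellinIntegrand_lower (p := p) (q := q) hD hw m (by linarith : -1 < σ)
    (by linarith)
  set F : ℝ → ℂ := fun t => mellinIntegrand p q D m w (σ + t * Complex.I) with hF
  have hFcont : Continuous F := by
    have := hcont.comp continuous_neg
    simpa [Function.comp_def, hF] using this
  have h1 : ‖∫ t in (0 : ℝ)..r.2, F t‖ ≤ T := by
    have e1 : ∫ t in (0 : ℝ)..r.2, F t = conj (∫ t in (0 : ℝ)..r.2,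
        mellinIntegrand p q D m w (σ + (-t : ℝ) * Complex.I)) := by
      rw [← intervalIntegral.intervalIntegral_conj]
      refine intervalIntegral.integral_congr fun t _ => ?_
      have hs0 : (σ : ℂ) + (-t : ℝ) * Complex.I ≠ 0 := fun h => hσ0 (by
        simpa using congrArg Complex.re h)
      simp only [hF]
      rw [← mellinIntegrand_conj hD hp m hw hs0]
      congr 1
      simp
    rw [e1, Complex.norm_conj]
    exact hlow r.2 hr.2
  have h2 : ‖∫ t in (-r.1)..0, F t‖ ≤ T := by
    have e1 := intervalIntegral.integral_comp_neg (a := 0) (b := r.1) F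
    rw [neg_zero] at e1
    rw [← e1]
    exact hlow r.1 hr.1
  rw [truncatedVerticalIntegral, intervalIntegral.integral_mul_const, norm_mul, norm_mul, norm_inv,
    norm_mul, norm_mul, Complex.norm_I, mul_one, mul_one, Complex.norm_ofNat, Complex.norm_real,
    Real.norm_of_nonneg Real.pi_pos.le,
    ← intervalIntegral.integral_add_adjacent_intervals (hFcont.intervalIntegrable (-r.1) 0)
    (hFcont.intervalIntegrable 0 r.2)]
  have h3 := (norm_add_le (∫ t in (-r.1)..0, F t) (∫ t in (0 : ℝ)..r.2, F t)).trans
    (add_le_add h2 h1)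
  calc _ ≤ (2 * Real.pi)⁻¹ * (T + T) := by gcongr
    _ = _ := by
      rw [hT]
      field_simp
      ring

end Bound

end Bounds

/-! ### Specialisation to the number field -/

section NumberFields

lemma HasVerticalIntegral.congr {F G : ℂ → ℂ} {c : ℝ} {I : ℂ} (h : HasVerticalIntegral F c I)
    (hFG : ∀ s : ℂ, s.re = c → F s = G s) : HasVerticalIntegral G c I := by
  have : truncatedVerticalIntegral G c = truncatedVerticalIntegral F c := by
    funext a b
    simp only [truncatedVerticalIntegral]
    congr 1
    refine intervalIntegral.integral_congr fun t _ => ?_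
    exact congrArg (· * Complex.I) (hFG _ (by simp)).symm
  unfold HasVerticalIntegral
  rw [this]
  exact h

lemma sin_pi_mul_ne_zero_of_re {s : ℂ} (h1 : -1 < s.re) (h2 : s.re < 1) (h0 : s.re ≠ 0) :
    Complex.sin (Real.pi * s) ≠ 0 := by
  rw [Ne, Complex.sin_eq_zero_iff]
  rintro ⟨k, hk⟩
  have hpi : (Real.pi : ℂ) ≠ 0 := by exact_mod_cast Real.pi_ne_zero
  have hs : s = k := by
    apply mul_left_cancel₀ hpi
    rw [hk, mul_comm]
  rw [hs, Complex.intCast_re] at h1 h2 h0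
  have h3 : -1 < k := by exact_mod_cast h1
  have h4 : k < 1 := by exact_mod_cast h2
  have h5 : k = 0 := by omega
  exact h0 (by simp [h5])

section NumberField

open NumberField NumberField.InfinitePlace

variable (K : Type*) [Field K] [NumberField K]

lemma degree_eq_add : degree K
    = (nrRealPlaces K + nrComplexPlaces K) + nrComplexPlaces K := by
  rw [degree, ← card_add_two_mul_card_eq_rank]
  ring

lemma absDiscr_pos : 0 < absDiscr K := by
  have : 0 < |discr K| := abs_pos.mpr (discr_ne_zero K)
  unfold absDiscr
  exact_mod_cast this

lemma gammaFactor_eq_phi (s : ℂ) : gammaFactor K s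
    = phi (nrRealPlaces K + nrComplexPlaces K) (nrComplexPlaces K) (absDiscr K) s := by
  have h2 : (2 : ℂ) ^ (1 - s) / (Real.pi : ℂ) ^ s = 2 * ((2 * Real.pi : ℝ) : ℂ) ^ (-s) := by
    have e1 : ((2 * Real.pi : ℝ) : ℂ) ^ (-s) = ((2 : ℝ) : ℂ) ^ (-s) * (Real.pi : ℂ) ^ (-s) := by
      rw [Complex.ofReal_mul, Complex.mul_cpow_ofReal_nonneg (by norm_num) Real.pi_pos.le]
    rw [e1, Complex.cpow_sub _ _ (by norm_num), Complex.cpow_one, Complex.cpow_neg, Complex.cpow_neg]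
    push_cast
    field_simp
  rw [gammaFactor, h2, degree_eq_add K, phi]
  simp only [gCos, gSin, mul_pow, pow_add]
  ring

variable {K}

/-- The restriction on Re s keeps s away from the integers, where the reflection argument breaks
down. -/
lemma inv_gammaFactor_eq {s : ℂ} (h1 : -1 < s.re) (h2 : s.re < 1) (h0 : s.re ≠ 0) :
    (gammaFactor K s)⁻¹
      = phi (nrRealPlaces K + nrComplexPlaces K) (nrComplexPlaces K) (absDiscr K) (1 - s) := by
  rw [gammaFactor_eq_phi]
  exact inv_eq_of_mul_eq_one_right
    (phi_mul_phi_one_sub _ _ (absDiscr_pos K) (sin_pi_mul_ne_zero_of_re h1 h2 h0))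

lemma nrPlaces_ne_zero (hn : 2 ≤ degree K) : nrRealPlaces K + nrComplexPlaces K ≠ 0 := by
  have := degree_eq_add K
  omega

lemma kernelIntegrand_eq (hn : 2 ≤ degree K) (w : ℝ) {s : ℂ} (h1 : -1 < s.re) (h2 : s.re < 1)
    (h0 : s.re ≠ 0) : kernelIntegrand K w s = mellinIntegrand (nrRealPlaces K + nrComplexPlaces K)
      (nrComplexPlaces K) (absDiscr K) (degree K) w s := by
  rw [mellinIntegrand_of_ne_zero (nrPlaces_ne_zero hn) _ _ (fun h => h0 (by simp [h])),
    kernelIntegrand, inv_gammaFactor_eq h1 h2 h0]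

lemma kernelDerivIntegrand_eq (hn : 2 ≤ degree K) (w : ℝ) {s : ℂ} (h1 : -1 < s.re) (h2 : s.re < 1)
    (h0 : s.re ≠ 0) : kernelDerivIntegrand K w s
      = mellinIntegrand (nrRealPlaces K + nrComplexPlaces K)
      (nrComplexPlaces K) (absDiscr K) 0 w s := by
  rw [mellinIntegrand_of_ne_zero (nrPlaces_ne_zero hn) _ _ (fun h => h0 (by simp [h])),
    kernelDerivIntegrand, inv_gammaFactor_eq h1 h2 h0]
  simp

end NumberField

/-! ### Comparison of the constants with Q₂ and Q₃ -/

section Numerics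

lemma exp_four_ge : (54.5 : ℝ) ≤ Real.exp 4 := by
  have h : Real.exp 4 = Real.exp 1 ^ 4 := by rw [← Real.exp_nat_mul]; norm_num
  rw [h]
  calc (54.5 : ℝ) ≤ 2.718281828 ^ 4 := by norm_num
    _ ≤ _ := by gcongr; linarith [Real.exp_one_gt_d9]

lemma exp_five_ge : (147 : ℝ) ≤ Real.exp 5 := by
  have h : Real.exp 5 = Real.exp 1 ^ 5 := by rw [← Real.exp_nat_mul]; norm_num
  rw [h]
  calc (147 : ℝ) ≤ 2.718281828 ^ 5 := by norm_num
    _ ≤ _ := by gcongr; linarith [Real.exp_one_gt_d9]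

lemma exp_four_point_four_le : Real.exp 4.4 ≤ 82 := by
  have h : Real.exp 4.4 ^ 5 = Real.exp 1 ^ 22 := by
    rw [← Real.exp_nat_mul, ← Real.exp_nat_mul]; norm_num
  refine le_of_pow_le_pow_left₀ (n := 5) (by norm_num) (by norm_num) ?_
  rw [h]
  calc Real.exp 1 ^ 22 ≤ 2.7182818286 ^ 22 := by gcongr; exact Real.exp_one_lt_d9.le
    _ ≤ _ := by norm_num

lemma exp_neg_half_ge : (0.6 : ℝ) ≤ Real.exp (-(1 / 2)) := by
  have h : Real.exp (-(1 / 2)) ^ 2 = (Real.exp 1)⁻¹ := by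
    rw [← Real.exp_nat_mul, ← Real.exp_neg]; norm_num
  refine le_of_pow_le_pow_left₀ (n := 2) (by norm_num) (by positivity) ?_
  rw [h, le_inv_comm₀ (by norm_num) (by positivity)]
  refine Real.exp_one_lt_d9.le.trans ?_
  norm_num

lemma sqrt_pi_ge : (1.77 : ℝ) ≤ Real.sqrt Real.pi :=
  Real.le_sqrt_of_sq_le (by linarith [Real.pi_gt_d2])

lemma sqrt_pi_le : Real.sqrt Real.pi ≤ 1.78 := by
  rw [Real.sqrt_le_left (by norm_num)]
  linarith [Real.pi_lt_d2]

lemma pi_rpow_half_sub (x : ℝ) :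
    Real.pi ^ (x / 2 - 3 / 2) = Real.sqrt Real.pi ^ x / Real.sqrt Real.pi ^ 3 := by
  rw [Real.sqrt_eq_rpow, ← Real.rpow_mul Real.pi_pos.le, ← Real.rpow_natCast,
    ← Real.rpow_mul Real.pi_pos.le, ← Real.rpow_sub Real.pi_pos]
  congr 1
  push_cast
  ring

lemma constant_lower_bound {n : ℕ} (hn : 2 ≤ n) :
    (0.7 : ℝ) ≤ (2 : ℝ) ^ (3 / 2 : ℝ) / Real.sqrt Real.pi ^ 3 * Real.exp (-(1 / 2))
      * Real.sqrt (3 * (n : ℝ)) := by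
  have hn' : (2 : ℝ) ≤ n := by exact_mod_cast hn
  have h1 : (2.82 : ℝ) ≤ (2 : ℝ) ^ (3 / 2 : ℝ) := by
    have : (2 : ℝ) ^ (3 / 2 : ℝ) = 2 * Real.sqrt 2 := by
      rw [Real.sqrt_eq_rpow, ← Real.rpow_one_add' (by norm_num) (by norm_num)]
      norm_num
    rw [this]
    have : (1.41 : ℝ) ≤ Real.sqrt 2 := Real.le_sqrt_of_sq_le (by norm_num)
    linarith
  have h2 : (2.44 : ℝ) ≤ Real.sqrt (3 * (n : ℝ)) := Real.le_sqrt_of_sq_le (by linarith)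
  have h3 := sqrt_pi_le
  have h4 := exp_neg_half_ge
  have h5 : 0 < Real.sqrt Real.pi := Real.sqrt_pos.mpr Real.pi_pos
  calc (0.7 : ℝ) ≤ 2.82 / 1.78 ^ 3 * 0.6 * 2.44 := by norm_num
    _ ≤ _ := by gcongr

/-- Up to a factor bounded below by 0.7, Q₂ is the n-th power of e⁴/√π > 30. -/
lemma le_Q₂ {n : ℕ} (hn : 2 ≤ n) : 0.7 * 30 ^ n ≤ Q₂ n := by
  have h5 : 0 < Real.sqrt Real.pi := Real.sqrt_pos.mpr Real.pi_pos
  have e1 : Q₂ n = (2 : ℝ) ^ (3 / 2 : ℝ) / Real.sqrt Real.pi ^ 3 * Real.exp (-(1 / 2))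
      * Real.sqrt (3 * (n : ℝ)) * (Real.exp 4 / Real.sqrt Real.pi) ^ n := by
    rw [Q₂, pi_rpow_half_sub, Real.rpow_neg h5.le, Real.rpow_natCast, sub_eq_add_neg (4 * (n : ℝ)),
      Real.exp_add, mul_comm (4 : ℝ), Real.exp_nat_mul, div_pow]
    field_simp
  rw [e1]
  have h6 : (30 : ℝ) ≤ Real.exp 4 / Real.sqrt Real.pi := by
    rw [le_div_iff₀ h5]
    linarith [sqrt_pi_le, exp_four_ge]
  have := constant_lower_bound hn
  gcongr

/-- Since 4n/(n-1) ≥ 4, the exponential part is at least the n-th power of 2√π e⁵ > 500. -/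
lemma le_Q₃ {n : ℕ} (hn : 2 ≤ n) : 0.7 * 500 ^ n ≤ Q₃ n := by
  have hn' : (2 : ℝ) ≤ n := by exact_mod_cast hn
  have h5 : 0 < Real.sqrt Real.pi := Real.sqrt_pos.mpr Real.pi_pos
  have h1 : Real.exp (n * 5) * Real.exp (-(1 / 2))
      ≤ Real.exp ((n : ℝ) * (1 + 4 * (n : ℝ) / ((n : ℝ) - 1)) - 1 / 2) := by
    rw [← Real.exp_add]
    apply Real.exp_le_exp.mpr
    have : 4 ≤ 4 * (n : ℝ) / ((n : ℝ) - 1) := by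
      rw [le_div_iff₀ (by linarith)]; linarith
    nlinarith
  have h6 : (500 : ℝ) ≤ 2 * Real.sqrt Real.pi * Real.exp 5 := by
    calc (500 : ℝ) ≤ 2 * 1.77 * 147 := by norm_num
      _ ≤ _ := by
        have := sqrt_pi_ge
        have := exp_five_ge
        gcongr
  have h7 := constant_lower_bound hn
  calc (0.7 : ℝ) * 500 ^ n ≤ (2 : ℝ) ^ (3 / 2 : ℝ) / Real.sqrt Real.pi ^ 3 * Real.exp (-(1 / 2))
      * Real.sqrt (3 * (n : ℝ)) * (2 * Real.sqrt Real.pi * Real.exp 5) ^ n := by gcongr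
    _ = 2 ^ ((n : ℝ) + 3 / 2) * Real.pi ^ ((n : ℝ) / 2 - 3 / 2)
        * (Real.exp (n * 5) * Real.exp (-(1 / 2))) * Real.sqrt (3 * (n : ℝ)) := by
      rw [pi_rpow_half_sub, Real.rpow_add (by norm_num), Real.rpow_natCast, Real.rpow_natCast,
        Real.exp_nat_mul, mul_pow, mul_pow]
      ring
    _ ≤ Q₃ n := by
      rw [Q₃]
      gcongr

lemma exp_le_pow (n : ℕ) : Real.exp (4.4 * n) ≤ 82 ^ n := by
  rw [mul_comm, Real.exp_nat_mul]
  have := exp_four_point_four_le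
  gcongr

lemma polynomial_le_pow {n : ℕ} (hn : 2 ≤ n) : 13 + 2 * ((n : ℝ) + 1) ^ 2 ≤ 82 ^ n := by
  induction n, hn using Nat.le_induction with
  | base => norm_num
  | succ k hk ih =>
    rw [pow_succ (82 : ℝ)]
    push_cast
    have : (2 : ℝ) ≤ k := by exact_mod_cast hk
    nlinarith

lemma two_pi_rpow_neg_half_le : (2 * Real.pi) ^ (-(1 / 2) : ℝ) ≤ 0.4 := by
  rw [Real.rpow_neg Real.two_pi_pos.le, ← Real.sqrt_eq_rpow]
  have : (2.5 : ℝ) ≤ Real.sqrt (2 * Real.pi) :=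
    Real.le_sqrt_of_sq_le (by linarith [Real.pi_gt_d2])
  calc (Real.sqrt (2 * Real.pi))⁻¹ ≤ 2.5⁻¹ := by gcongr
    _ ≤ _ := by norm_num

lemma pi_inv_le : Real.pi⁻¹ ≤ 1 / 3 := by
  rw [one_div]
  have := Real.pi_gt_three
  gcongr

lemma kernel_constant_le_Q₂ {n : ℕ} (hn : 2 ≤ n) :
    Real.pi⁻¹ * (8 * 10 ^ n + (2 * Real.pi) ^ (-((n : ℝ) + 1 / 2)) *
      (13 + 2 * (Real.exp (4.4 * n) + (n + 1) ^ 2))) ≤ Q₂ n := by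
  refine le_trans ?_ (le_Q₂ hn)
  have h1 : (2 * Real.pi) ^ (-((n : ℝ) + 1 / 2)) ≤ (1 / 6.28) ^ n * 0.4 := by
    rw [neg_add, Real.rpow_add Real.two_pi_pos, Real.rpow_neg Real.two_pi_pos.le, Real.rpow_natCast,
      one_div_pow, ← one_div]
    have := two_pi_rpow_neg_half_le
    have : (6.28 : ℝ) ≤ 2 * Real.pi := by linarith [Real.pi_gt_d2]
    gcongr
  have h2 : 13 + 2 * (Real.exp (4.4 * n) + ((n : ℝ) + 1) ^ 2) ≤ 3 * 82 ^ n := by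
    linarith [exp_le_pow n, polynomial_le_pow hn]
  -- The base 13.1 is just above 82/6.28, the growth rate of the Stirling error e^(4.4 n) divided by
  -- (2π)^n. The remaining ratio 30/13.1 already suffices at n = 2.
  have h3 : (10 : ℝ) ^ n ≤ 13.1 ^ n := by gcongr; norm_num
  have h4 : (1 / 6.28 : ℝ) ^ n * 82 ^ n ≤ 13.1 ^ n := by
    rw [← mul_pow]
    gcongr
    norm_num
  have h5 : (13.1 : ℝ) ^ n * (30 / 13.1) ^ n = 30 ^ n := by
    rw [← mul_pow]
    norm_num
  have h6 : (30 / 13.1 : ℝ) ^ 2 ≤ (30 / 13.1) ^ n := pow_le_pow_right₀ (by norm_num) hn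
  have h7 : (0 : ℝ) < 13.1 ^ n := by positivity
  calc _ ≤ (1 / 3 : ℝ) * (8 * 13.1 ^ n + (1 / 6.28) ^ n * 0.4 * (3 * 82 ^ n)) := by
        have := pi_inv_le
        gcongr
    _ ≤ (1 / 3 : ℝ) * (9.2 * 13.1 ^ n) := by linarith
    _ ≤ (0.7 : ℝ) * (13.1 ^ n * (30 / 13.1) ^ 2) := by linarith
    _ ≤ (0.7 : ℝ) * (13.1 ^ n * (30 / 13.1) ^ n) := by gcongr
    _ = _ := by rw [h5]

lemma kernelDeriv_constant_le_Q₃ {n : ℕ} (hn : 2 ≤ n) :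
    Real.pi⁻¹ * (8 * 10 ^ n + (2 * Real.pi) ^ (-(((0 : ℕ) : ℝ) + 1 / 2)) *
      (13 + 2 * (Real.exp (4.4 * n) + (((0 : ℕ) : ℝ) + 1) ^ 2))) ≤ Q₃ n := by
  refine le_trans ?_ (le_Q₃ hn)
  rw [Nat.cast_zero, zero_add, zero_add, one_pow]
  have h2 : 13 + 2 * (Real.exp (4.4 * n) + 1) ≤ 3 * 82 ^ n := by
    have h3 : (82 : ℝ) ^ 2 ≤ 82 ^ n := pow_le_pow_right₀ (by norm_num) hn
    linarith [exp_le_pow n]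
  have h3 : (10 : ℝ) ^ n ≤ 82 ^ n := by gcongr; norm_num
  have h5 : (82 : ℝ) ^ n * (500 / 82) ^ n = 500 ^ n := by
    rw [← mul_pow]
    norm_num
  have h6 : (500 / 82 : ℝ) ^ 2 ≤ (500 / 82) ^ n := pow_le_pow_right₀ (by norm_num) hn
  have h7 : (0 : ℝ) < 82 ^ n := by positivity
  calc _ ≤ (1 / 3 : ℝ) * (8 * 82 ^ n + 0.4 * (3 * 82 ^ n)) := by
        have := pi_inv_le
        have := two_pi_rpow_neg_half_le
        gcongr
    _ ≤ (0.7 : ℝ) * (82 ^ n * (500 / 82) ^ 2) := by linarith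
    _ ≤ (0.7 : ℝ) * (82 ^ n * (500 / 82) ^ n) := by gcongr
    _ = _ := by rw [h5]

end Numerics

/-- Comparing with real parts, |s| ≥ 1/2, |s + 1| ≥ 1/4 and all later factors are at least 1. -/
lemma one_le_eight_mul_norm_prod {σ : ℝ} (h1 : -(3 / 4) ≤ σ) (h2 : σ ≤ -(1 / 2)) {m : ℕ}
    (hm : m ≠ 0) (t : ℝ) :
    1 ≤ 8 * ‖∏ j ∈ Finset.range (m + 1), ((σ + (-t : ℝ) * Complex.I) + (j : ℂ))‖ := by
  obtain ⟨k, rfl⟩ := Nat.exists_eq_succ_of_ne_zero hm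
  have hre : ∀ j : ℕ, |σ + j| ≤ ‖(σ + (-t : ℝ) * Complex.I) + (j : ℂ)‖ := fun j => by
    refine le_trans (le_of_eq ?_) (Complex.abs_re_le_norm _)
    simp
  rw [Finset.prod_range_succ', Finset.prod_range_succ', norm_mul, norm_mul, norm_prod]
  have e0 : (1 / 2 : ℝ) ≤ ‖(σ + (-t : ℝ) * Complex.I) + ((0 : ℕ) : ℂ)‖ := by
    refine le_trans ?_ (hre 0)
    rw [Nat.cast_zero, add_zero, abs_of_neg (by linarith)]
    linarith
  have e1 : (1 / 4 : ℝ) ≤ ‖(σ + (-t : ℝ) * Complex.I) + ((0 + 1 : ℕ) : ℂ)‖ := by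
    refine le_trans ?_ (hre (0 + 1))
    push_cast
    rw [abs_of_pos (by linarith)]
    linarith
  have e2 : (1 : ℝ) ≤ ∏ j ∈ Finset.range k, ‖(σ + (-t : ℝ) * Complex.I) + ((j + 1 + 1 : ℕ) : ℂ)‖ := by
    suffices h : ∀ j : ℕ, (1 : ℝ) ≤ ‖(σ + (-t : ℝ) * Complex.I) + ((j + 1 + 1 : ℕ) : ℂ)‖ by
      simpa using Finset.prod_le_prod (s := Finset.range k) (f := fun _ => (1 : ℝ))
        (fun _ _ => zero_le_one) (fun j _ => h j)
    intro j
    refine le_trans ?_ (hre (j + 1 + 1))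
    have : (0 : ℝ) ≤ j := by positivity
    push_cast
    rw [abs_of_pos (by linarith)]
    linarith
  calc (1 : ℝ) = 8 * (1 * (1 / 4) * (1 / 2)) := by norm_num
    _ ≤ _ := by gcongr

end NumberFields

end LandauKernel

end

theorem theorem4p2 (K : Type*) [Field K] [NumberField K] (hn : 2 ≤ LandauKernel.degree K) :
    -- the integral defining `K(w)` converges, the line of integration may be replaced by any
    -- line `Re s = -η` with `0 < η < 1/2`, and `K(w)` is bounded as claimed
    (∀ w : ℝ, 0 < w →
      LandauKernel.HasVerticalIntegral (LandauKernel.kernelIntegrand K w)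
          (LandauKernel.kernelLine K) (LandauKernel.kernel K w) ∧
        (∀ η : ℝ, 0 < η → η < 1 / 2 →
          LandauKernel.HasVerticalIntegral (LandauKernel.kernelIntegrand K w) (-η)
            (LandauKernel.kernel K w)) ∧
        ‖LandauKernel.kernel K w‖ ≤
          LandauKernel.Q₂ (LandauKernel.degree K)
            * LandauKernel.absDiscr K ^ (1 + 1 / (2 * (LandauKernel.degree K : ℝ)))
            * w ^ ((LandauKernel.degree K : ℝ) - 1 / 2
                - 1 / (2 * (LandauKernel.degree K : ℝ)))) ∧
    -- `K(w)` is `n` times continuously differentiable on `(0, ∞)`; its `n`-th derivative is the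
    -- (convergent) second contour integral and is bounded as claimed
    ContDiffOn ℝ (LandauKernel.degree K) (LandauKernel.kernel K) (Set.Ioi 0) ∧
    (∀ w : ℝ, 0 < w →
      LandauKernel.HasVerticalIntegral (LandauKernel.kernelDerivIntegrand K w)
          (LandauKernel.kernelDerivLine K)
          (iteratedDeriv (LandauKernel.degree K) (LandauKernel.kernel K) w) ∧
        ‖iteratedDeriv (LandauKernel.degree K) (LandauKernel.kernel K) w‖ ≤
          LandauKernel.Q₃ (LandauKernel.degree K)
            * LandauKernel.absDiscr K ^ (1 / (2 * (LandauKernel.degree K : ℝ)))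
            * w ^ ((1 : ℝ) / 2 - 1 / (2 * (LandauKernel.degree K : ℝ)))) := by
  set n := LandauKernel.degree K with hnd
  have hn' : (2 : ℝ) ≤ n := by exact_mod_cast hn
  have hn0 : (0 : ℝ) < n := by linarith
  -- This places both extreme lines in the strip -3/4 ≤ Re s ≤ 1/2 used above, the second one at Re
  -- s ≥ 1/4.
  have hinv : 1 / (2 * (n : ℝ)) ≤ 1 / 4 := one_div_le_one_div_of_le (by norm_num) (by linarith)
  have hinv0 : 0 < 1 / (2 * (n : ℝ)) := by positivity
  have hcancel : (n : ℝ) * (1 / (2 * (n : ℝ))) = 1 / 2 := by field_simp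
  have hD := LandauKernel.absDiscr_pos K
  have hp := LandauKernel.nrPlaces_ne_zero hn
  set p := NumberField.InfinitePlace.nrRealPlaces K + NumberField.InfinitePlace.nrComplexPlaces K
  set q := NumberField.InfinitePlace.nrComplexPlaces K
  have hnpq : n = p + q := LandauKernel.degree_eq_add K
  have hnpqr : ((p + q : ℕ) : ℝ) = n := by rw [← hnpq]
  have hpq : 2 ≤ p + q := hnpq ▸ hn
  have hshift : ∀ w : ℝ, 0 < w → ∀ c : ℝ, LandauKernel.kernelLine K ≤ c → c < 0 →
      LandauKernel.HasVerticalIntegral (LandauKernel.kernelIntegrand K w) c (LandauKernel.mellinIntegral p q (LandauKernel.absDiscr K) n w) := by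
    intro w hw c hc hc0
    have hc' : -(1 / 2) - 1 / (2 * (n : ℝ)) ≤ c := hc
    refine (LandauKernel.hasVerticalIntegral_mellinIntegrand hD hp hpq n hw (by linarith : -(3 / 4) ≤ c)
      (by linarith) ?_).congr fun s hs => ?_
    -- The condition n (1/2 - c) ≤ n + 1/2 amounts to c ≥ -1/2 - 1/(2n), with equality on the kernel
    -- line.
    · rw [hnpqr]
      nlinarith
    · exact (LandauKernel.kernelIntegrand_eq hn w (by linarith) (by linarith) (by linarith)).symm
  have hline : LandauKernel.kernelLine K < 0 := by
    change -(1 / 2) - 1 / (2 * (n : ℝ)) < 0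
    linarith
  have hkernel : ∀ w : ℝ, 0 < w → LandauKernel.kernel K w = LandauKernel.mellinIntegral p q (LandauKernel.absDiscr K) n w :=
    fun w hw => (hshift w hw _ le_rfl hline).verticalIntegral_eq
  have hderiv := fun (m : ℕ) (w : ℝ) (hw : 0 < w) =>
    LandauKernel.hasDerivAt_mellinIntegral (q := q) hD hp hpq m hw
  have hiter : ∀ w : ℝ, 0 < w →
      iteratedDeriv n (LandauKernel.kernel K) w = LandauKernel.mellinIntegral p q (LandauKernel.absDiscr K) 0 w :=
    LandauKernel.iteratedDeriv_eq_of_hasDerivAt_succ hderiv n 0 fun w hw => by rw [zero_add, hkernel w hw]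
  refine ⟨fun w hw => ⟨?_, fun η hη hη' => ?_, ?_⟩, ?_, fun w hw => ⟨?_, ?_⟩⟩
  · rw [hkernel w hw]
    exact hshift w hw _ le_rfl hline
  · rw [hkernel w hw]
    refine hshift w hw _ ?_ (by linarith)
    change -(1 / 2) - 1 / (2 * (n : ℝ)) ≤ -η
    linarith
  · rw [hkernel w hw]
    refine (LandauKernel.norm_mellinIntegral_le hD hp hpq hw (σ := -(1 / 2) - 1 / (2 * (n : ℝ))) (by linarith)
      (by linarith) (by linarith) (by rw [hnpqr]; linarith)
      (LandauKernel.one_le_eight_mul_norm_prod (by linarith) (by linarith) (by omega))).trans ?_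
    have e1 : -(1 / 2) - 1 / (2 * (n : ℝ)) + n = n - 1 / 2 - 1 / (2 * (n : ℝ)) := by ring
    have e2 : 1 / 2 - (-(1 / 2) - 1 / (2 * (n : ℝ))) = 1 + 1 / (2 * (n : ℝ)) := by ring
    rw [e1, e2, ← hnpq, mul_comm, mul_comm (w ^ _), ← mul_assoc]
    gcongr
    exact LandauKernel.kernel_constant_le_Q₂ hn
  · exact (LandauKernel.contDiffOn_of_hasDerivAt_succ (LandauKernel.continuousOn_mellinIntegral hD hp hpq 0) hderiv n).congr
      fun w hw => hkernel w hw
  · rw [hiter w hw]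
    refine (LandauKernel.hasVerticalIntegral_mellinIntegrand hD hp hpq 0 hw
      (c := 1 / 2 - 1 / (2 * (n : ℝ))) (by linarith)
      (by linarith) ?_).congr fun s hs => ?_
    · rw [hnpqr]
      push_cast
      linarith
    · exact (LandauKernel.kernelDerivIntegrand_eq hn w (by linarith) (by linarith) (by linarith)).symm
  · rw [hiter w hw]
    refine (LandauKernel.norm_mellinIntegral_le hD hp hpq hw (m := 0) (σ := 1 / 2 - 1 / (2 * (n : ℝ)))
      (by linarith) (by linarith) (by linarith) (by rw [hnpqr]; push_cast; linarith)
      (fun t => ?_)).trans ?_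
    -- For m = 0 the product is s alone, and |s| ≥ Re s ≥ 1/4.
    · have h1 := Complex.abs_re_le_norm
        (((1 / 2 - 1 / (2 * (n : ℝ)) : ℝ) : ℂ) + (-t : ℝ) * Complex.I)
      have h2 : (((1 / 2 - 1 / (2 * (n : ℝ)) : ℝ) : ℂ) + (-t : ℝ) * Complex.I).re
          = 1 / 2 - 1 / (2 * (n : ℝ)) := by
        rw [Complex.add_re, Complex.re_ofReal_mul, Complex.I_re, mul_zero, add_zero,
          Complex.ofReal_re]
      rw [h2, abs_of_pos (by linarith)] at h1
      rw [zero_add, Finset.prod_range_one, Nat.cast_zero, add_zero]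
      linarith
    · have e1 : 1 / 2 - 1 / (2 * (n : ℝ)) + ((0 : ℕ) : ℝ) = 1 / 2 - 1 / (2 * (n : ℝ)) := by simp
      have e2 : 1 / 2 - (1 / 2 - 1 / (2 * (n : ℝ))) = 1 / (2 * (n : ℝ)) := by ring
      rw [e1, e2, ← hnpq, mul_comm, mul_comm (w ^ _), ← mul_assoc]
      gcongr
      exact LandauKernel.kernelDeriv_constant_le_Q₃ hn
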